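/- For $a\in\mathbb R$ write $\langle a\rangle=(1+a^2)^{1/2}$, and let $\widetilde u(\tau,\xi)$ denote the space-time Fourier transform of a tempered distribution $u$ on $\mathbb R^{1+1}=\mathbb R_t\times\mathbb R_x$. For $s,b\in\mathbb R$ and a choice of sign $\pm$ put $$\|u\|_{Z^{s,b}_\pm}=\big\|\langle\tau\mp\xi\rangle^s\langle\tau\pm\xi\rangle^b\,\widetilde u(\tau,\xi)\big\|_{L^2_{\tau,\xi}},\qquad \|u\|_{Y^{s,b}_\pm}=\big\|\langle\xi\rangle^s\langle\tau\pm\xi\rangle^b\,\widetilde u(\tau,\xi)\big\|_{L^2_\xi L^1_\tau},$$ where the norms are $+\infty$ if $\widetilde u$ is not a function. Let $-\frac12<s\le 0$, $0<\epsilon<\frac12$ and $\frac12<b<\min\{1+s,1-\epsilon\}$. Let $\rho,\sigma\in C_0^\infty(\mathbb R)$ satisfy $\rho(t)=1$ for $t\in[-1,1]$, $\sigma(t)=1$ for $t\in\operatorname{supp}\rho$, and $\operatorname{supp}\rho\subset\operatorname{supp}\sigma\subset[-2,2]$. For $0<T<1$ set $\rho_T(t)=\rho(t/T)$ and $\sigma_T(t)=\sigma(t/T)$.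 Then, for either choice of sign, there is a constant $C$, depending on $s,b,\epsilon,\rho,\sigma$ but not on $T$, $\psi$ or $F$, such that for all $0<T<1$ and all tempered distributions $\psi,F$ on $\mathbb R^{1+1}$ with $$\partial_t\psi\pm\partial_x\psi=F$$ in the sense of distributions, one has $$\|\rho_T(t)\,\psi\|_{Z^{s,b}_\pm}\le C\Big(T^{\frac12-b}\,\|\sigma_T(t)\,\psi\|_{Y^{s,0}_\pm}+T^{\epsilon}\,\|F\|_{Z^{s,b-1+\epsilon}_\pm}\Big).$$ -/

import Mathlib

open MeasureTheory
open scoped ENNReal NNReal ContDiff SchwartzMap FourierTransform LineDeriv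

noncomputable section

namespace NullEnergy

/-- Space-time `ℝ^{1+1}` with the Euclidean inner product; the first coordinate is the time `t`
(dual variable `τ`), the second one is the space variable `x` (dual variable `ξ`). -/
abbrev Spacetime : Type := WithLp 2 (ℝ × ℝ)

/-- The point `(t, x)`. -/
def pt (t x : ℝ) : Spacetime := WithLp.toLp 2 (t, x)

/-- The Japanese bracket `⟨a⟩ = (1 + a²)^{1/2}`. -/
def bracket (a : ℝ) : ℝ := Real.sqrt (1 + a ^ 2)

/-- The space-time Fourier transform of the tempered distribution `u` is (integration against) the
function `g(τ, ξ)`. -/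
def HasFourierDensity (u : 𝓢'(Spacetime, ℂ)) (g : ℝ × ℝ → ℂ) : Prop :=
  AEStronglyMeasurable g volume ∧
    ∀ φ : 𝓢(Spacetime, ℂ),
      Integrable (fun p : ℝ × ℝ => φ (pt p.1 p.2) * g p) volume ∧
        (𝓕 u) φ = ∫ p : ℝ × ℝ, φ (pt p.1 p.2) * g p

/-- The norm `‖⟨τ ∓ ξ⟩^s ⟨τ ± ξ⟩^b ũ(τ, ξ)‖_{L²_{τ,ξ}}` of `Z^{s,b}_±`, where `κ = ±1` is the sign.
The density `ũ` is unique up to null sets, so the infimum is over at most one value;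
the norm is `∞` if the Fourier transform of `u` is not a function. -/
def ZNorm (κ s b : ℝ) (u : 𝓢'(Spacetime, ℂ)) : ℝ≥0∞ :=
  ⨅ (g : ℝ × ℝ → ℂ) (_ : HasFourierDensity u g),
    (∫⁻ p : ℝ × ℝ,
      (ENNReal.ofReal (bracket (p.1 - κ * p.2) ^ s * bracket (p.1 + κ * p.2) ^ b) *
        ‖g p‖ₑ) ^ (2 : ℝ)) ^ (1 / 2 : ℝ)

/-- The norm `‖⟨ξ⟩^s ⟨τ ± ξ⟩^b ũ(τ, ξ)‖_{L²_ξ L¹_τ}` of `Y^{s,b}_±`, where `κ = ±1` is the sign,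
with the same conventions as for `ZNorm`. -/
def YNorm (κ s b : ℝ) (u : 𝓢'(Spacetime, ℂ)) : ℝ≥0∞ :=
  ⨅ (g : ℝ × ℝ → ℂ) (_ : HasFourierDensity u g),
    (∫⁻ ξ : ℝ,
      (∫⁻ τ : ℝ,
        ENNReal.ofReal (bracket ξ ^ s * bracket (τ + κ * ξ) ^ b) * ‖g (τ, ξ)‖ₑ) ^ (2 : ℝ))
      ^ (1 / 2 : ℝ)

/-- The function `(t, x) ↦ η(t / T)` on space-time. -/
def timeCutoff (η : ℝ → ℂ) (T : ℝ) : Spacetime → ℂ := fun p => η (p.fst / T)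

/-- For a test function `η` the cutoff has temperate growth, so that multiplication by it
is the usual multiplication of a tempered distribution by a smooth function. -/
theorem timeCutoff_hasTemperateGrowth {η : ℝ → ℂ} (hη : ContDiff ℝ ∞ η)
    (hη' : HasCompactSupport η) (T : ℝ) : (timeCutoff η T).HasTemperateGrowth := by
  have h1 : η.HasTemperateGrowth := hη'.hasTemperateGrowth hη
  have h2 := (T⁻¹ • WithLp.fstL 2 ℝ ℝ ℝ : Spacetime →L[ℝ] ℝ).hasTemperateGrowth
  have h3 := h1.comp h2
  have h4 : timeCutoff η T = η ∘ (T⁻¹ • WithLp.fstL 2 ℝ ℝ ℝ : Spacetime →L[ℝ] ℝ) := by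
    ext p
    simp [timeCutoff, div_eq_inv_mul]
  rw [h4]
  exact h3

/-- The product `η(t / T) u` for a tempered distribution `u` on space-time. -/
def cutoffMul (η : ℝ → ℂ) (T : ℝ) (u : 𝓢'(Spacetime, ℂ)) : 𝓢'(Spacetime, ℂ) :=
  TemperedDistribution.smulLeftCLM ℂ (timeCutoff η T) u

/-- `∂_t ψ ± ∂_x ψ = F` in the sense of distributions, where `κ = ±1` is the sign. -/
def SolvesTransport (κ : ℝ) (ψ F : 𝓢'(Spacetime, ℂ)) : Prop :=
  ∂_{pt 1 0} ψ + κ • ∂_{pt 0 1} ψ = F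

end NullEnergy

end

namespace NullEnergy

/-! The function `ρ_T ψ` solves the transport equation with source term
`T⁻¹ (dρ/dt)(t / T) ψ + ρ_T F`, where `ψ` may be replaced by `σ_T ψ`. On the Fourier side a cutoff
in time is a convolution in `τ` with a kernel of mass `O(1)` and width `1 / T`, and the transport
operator is, up to a constant, multiplication by `l = τ + κξ`. Adding the bound for the transform
of `ρ_T ψ` itself to `T` times the bound for its product with `l` controls its product with `1 +
T|l|` by blurred versions of the transforms of `σ_T ψ` and `T F`.

It remains to move the weights through the blurring. A frequency shift of size `1 / T` costs at
most the factor `(1 + 1 / (T ⟨τ - κξ⟩))^(-s)` in `⟨τ - κξ⟩^s`, while the powers of `1 + T|l|` and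
`1 + T|ν|` lost for a shift `ν` are recovered from the division by `1 + T|l|` and from the decay of
the kernel. In the squared norms that factor occurs with the exponent `-2s < 1`, so it is
integrable against the kernel uniformly in `T`, and the Schur test applies. -/

/-! ### Pointwise bounds for the weights -/

theorem bracket_pos (a : ℝ) : 0 < bracket a := Real.sqrt_pos.2 (by positivity)

theorem one_le_bracket (a : ℝ) : 1 ≤ bracket a :=
  Real.one_le_sqrt.2 (by nlinarith [sq_nonneg a])

theorem abs_le_bracket (a : ℝ) : |a| ≤ bracket a :=
  Real.abs_le_sqrt (by linarith)

theorem bracket_le_add_abs_sub (a c : ℝ) : bracket a ≤ bracket c + |a - c| := by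
  have hc : bracket c ^ 2 = 1 + c ^ 2 := Real.sq_sqrt (by positivity)
  have hprod : c * (a - c) ≤ bracket c * |a - c| :=
    (le_abs_self _).trans ((abs_mul _ _).trans_le (by gcongr; exact abs_le_bracket c))
  refine Real.sqrt_le_iff.2 ⟨by have := bracket_pos c; positivity, ?_⟩
  nlinarith [sq_abs (a - c)]

theorem bracket_le_one_add_abs (a : ℝ) : bracket a ≤ 1 + |a| := by
  simpa [bracket] using bracket_le_add_abs_sub a 0

@[fun_prop]
theorem continuous_bracket : Continuous bracket := by
  unfold bracket; fun_prop

theorem rpow_le_mul_rpow_of_le_mul {x y c s : ℝ} (hx : 0 < x) (hc : 0 < c) (h : x ≤ c * y)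
    (hs : s ≤ 0) : y ^ s ≤ c ^ (-s) * x ^ s := by
  calc y ^ s ≤ (x / c) ^ s :=
        Real.rpow_le_rpow_of_nonpos (by positivity) ((div_le_iff₀' hc).2 h) hs
    _ = c ^ (-s) * x ^ s := by
        rw [Real.div_rpow hx.le hc.le, Real.rpow_neg hc.le, div_eq_inv_mul]

/-- The weight `⟨τ - κξ⟩^s ⟨τ + κξ⟩^b` of `ZNorm κ s b`. -/
noncomputable def zWeight (κ s b : ℝ) (p : ℝ × ℝ) : ℝ :=
  bracket (p.1 - κ * p.2) ^ s * bracket (p.1 + κ * p.2) ^ b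

theorem zWeight_pos (κ s b : ℝ) (p : ℝ × ℝ) : 0 < zWeight κ s b p :=
  mul_pos (Real.rpow_pos_of_pos (bracket_pos _) _) (Real.rpow_pos_of_pos (bracket_pos _) _)

@[fun_prop]
theorem measurable_zWeight (κ s b : ℝ) : Measurable (zWeight κ s b) := by
  unfold zWeight; fun_prop

/-- The factor `(d + 1 / T) / d` by which a quantity of size `d` can grow when the frequency moves
by `1 / T`, the resolution allowed by a time cutoff at scale `T`. -/
noncomputable def blurFactor (T d : ℝ) : ℝ := 1 + (T * d)⁻¹

theorem one_le_blurFactor {T d : ℝ} (hT : 0 < T) (hd : 0 < d) : 1 ≤ blurFactor T d :=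
  le_add_of_nonneg_right (by positivity)

theorem blurFactor_mul_self {T d : ℝ} (hT : 0 < T) (hd : 0 < d) :
    blurFactor T d * d = d + T⁻¹ := by
  unfold blurFactor; field_simp

@[fun_prop]
theorem measurable_blurFactor (T : ℝ) : Measurable (blurFactor T) := by
  unfold blurFactor; fun_prop

theorem bracket_le_div {T : ℝ} (hT : 0 < T) (hT1 : T ≤ 1) (l : ℝ) :
    bracket l ≤ (1 + T * |l|) / T := by
  have h := bracket_le_one_add_abs l
  rw [le_div_iff₀ hT]
  nlinarith [abs_nonneg l]

theorem bracket_le_mul_div {T : ℝ} (hT : 0 < T) (hT1 : T ≤ 1) (l l' : ℝ) :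
    bracket l' ≤ (1 + T * |l - l'|) * ((1 + T * |l|) / T) := by
  refine (bracket_le_div hT hT1 l').trans ?_
  rw [← mul_div_assoc]
  gcongr
  have htri : T * |l'| ≤ T * (|l - l'| + |l|) := by
    gcongr
    rw [abs_sub_comm]
    simpa using abs_add_le (l' - l) l
  have : 0 ≤ T * |l - l'| * (T * |l|) := by positivity
  linarith

theorem bracket_le_mul_bracket {T : ℝ} (hT : 0 < T) (a c : ℝ) :
    bracket a ≤ (blurFactor T (bracket c) * (1 + T * |a - c|)) * bracket c := by
  have hc := bracket_pos c
  calc bracket a ≤ bracket c + |a - c| := bracket_le_add_abs_sub a c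
    _ = bracket c + T⁻¹ * (T * |a - c|) := by field_simp
    _ ≤ (bracket c + T⁻¹) * (1 + T * |a - c|) := by
        have : 0 ≤ bracket c * (T * |a - c|) + T⁻¹ := by positivity
        linarith
    _ = _ := by rw [← blurFactor_mul_self hT hc]; ring

/-- `ξ` is a combination of the two null frequencies `τ ± κξ`. -/
theorem bracket_le_mul_bracket_null {κ T : ℝ} (hκ : κ ≠ 0) (hT : 0 < T) (τ ξ : ℝ) :
    bracket ξ ≤ ((1 + |κ|⁻¹) * blurFactor T (bracket (τ - κ * ξ)) * (1 + T * |τ + κ * ξ|)) *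
      bracket (τ - κ * ξ) := by
  set d := bracket (τ - κ * ξ)
  set l := τ + κ * ξ
  have hd : 1 ≤ d := one_le_bracket _
  have hξ : |ξ| ≤ |κ|⁻¹ * (d + |l|) := by
    rw [← div_eq_inv_mul, le_div_iff₀' (abs_pos.2 hκ), ← abs_mul]
    have : 2 * (κ * ξ) = l - (τ - κ * ξ) := by ring
    have habs : 2 * |κ * ξ| ≤ |l| + |τ - κ * ξ| := by
      rw [← abs_two, ← abs_mul, this]; exact abs_sub _ _
    linarith [abs_le_bracket (τ - κ * ξ), abs_nonneg l]
  calc bracket ξ ≤ 1 + |ξ| := bracket_le_one_add_abs ξ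
    _ ≤ (1 + |κ|⁻¹) * (d + |l|) := by linarith [abs_nonneg l]
    _ ≤ (1 + |κ|⁻¹) * ((d + T⁻¹) * (1 + T * |l|)) := by
        gcongr
        have : (d + T⁻¹) * (1 + T * |l|) = d + |l| + (T⁻¹ + d * (T * |l|)) := by field_simp; ring
        rw [this]
        exact le_add_of_nonneg_right (by positivity)
    _ = _ := by rw [← blurFactor_mul_self hT (by positivity)]; ring

theorem zWeight_le_mul {κ s b x y : ℝ} {p : ℝ × ℝ} (hx : bracket (p.1 - κ * p.2) ^ s ≤ x)
    (hb : 0 ≤ b) (hy : bracket (p.1 + κ * p.2) ≤ y) : zWeight κ s b p ≤ x * y ^ b :=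
  mul_le_mul hx (Real.rpow_le_rpow (bracket_pos _).le hy hb)
    (Real.rpow_nonneg (bracket_pos _).le _) ((Real.rpow_nonneg (bracket_pos _).le _).trans hx)

theorem zWeight_div_le {κ s b T : ℝ} (hκ : κ ≠ 0) (hs : -1 ≤ s) (hs' : s ≤ 0) (hb : 0 ≤ b)
    (hbs : b ≤ 1 + s) (hT : 0 < T) (hT1 : T ≤ 1) (p : ℝ × ℝ) :
    zWeight κ s b p / (1 + T * |p.1 + κ * p.2|) ≤
      (1 + |κ|⁻¹) * T ^ (-b) *
        (bracket p.2 ^ s * blurFactor T (bracket (p.1 - κ * p.2)) ^ (-s)) := by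
  have hd := bracket_le_mul_bracket_null hκ hT p.1 p.2
  have hl := bracket_le_div hT hT1 (p.1 + κ * p.2)
  set V := blurFactor T (bracket (p.1 - κ * p.2))
  set M := 1 + T * |p.1 + κ * p.2|
  set c := 1 + |κ|⁻¹
  have hV : 0 < V := one_pos.trans_le (one_le_blurFactor hT (bracket_pos _))
  have hM : 1 ≤ M := le_add_of_nonneg_right (by positivity)
  have hM0 : 0 < M := by positivity
  have hc : 1 ≤ c := le_add_of_nonneg_right (by positivity)
  have hξ : 0 < bracket p.2 := bracket_pos _
  calc zWeight κ s b p / M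
      ≤ ((c * V * M) ^ (-s) * bracket p.2 ^ s) * (M / T) ^ b / M := by
        gcongr
        exact zWeight_le_mul (rpow_le_mul_rpow_of_le_mul hξ (by positivity) hd hs') hb hl
    _ = c ^ (-s) * T ^ (-b) * (bracket p.2 ^ s * V ^ (-s)) * (M ^ (-s) * M ^ (b - 1)) := by
        rw [Real.mul_rpow (by positivity) (by positivity),
          Real.mul_rpow (by positivity) (by positivity), Real.div_rpow (by positivity) hT.le,
          Real.rpow_neg hT.le, Real.rpow_sub_one (by positivity) b]
        field_simp
    _ ≤ c * T ^ (-b) * (bracket p.2 ^ s * V ^ (-s)) * 1 := by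
        rw [← Real.rpow_add hM0]
        gcongr
        · exact Real.rpow_le_self_of_one_le hc (by linarith)
        · exact Real.rpow_le_one_of_one_le_of_nonpos hM (by linarith)
    _ = _ := mul_one _

theorem mul_rpow_div_le {ε T M : ℝ} (hε : 0 ≤ ε) (b : ℝ) (hT : 0 < T) (hM : 1 ≤ M) :
    T * ((M / T) ^ b / M) ≤ T ^ ε * (M / T) ^ (b - 1 + ε) := by
  have hMT : 0 < M / T := by positivity
  calc T * ((M / T) ^ b / M) = T ^ ε * (M / T) ^ (b - 1 + ε) * M ^ (-ε) := by
        rw [Real.rpow_add hMT, Real.rpow_sub_one hMT.ne', Real.div_rpow (by positivity) hT.le ε,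
          Real.rpow_neg (by positivity)]
        field_simp
    _ ≤ _ := mul_le_of_le_one_right (by positivity)
        (Real.rpow_le_one_of_one_le_of_nonpos hM (by linarith))

theorem mul_zWeight_div_le {κ s ε b T : ℝ} (hs : -1 ≤ s) (hs' : s ≤ 0) (hε : 0 ≤ ε) (hb : 0 ≤ b)
    (hbε : b ≤ 1 - ε) (hT : 0 < T) (hT1 : T ≤ 1) (τ τ' ξ : ℝ) :
    T * (zWeight κ s b (τ, ξ) / (1 + T * |τ + κ * ξ|)) ≤
      T ^ ε * blurFactor T (bracket (τ - κ * ξ)) ^ (-s) * (1 + T * |τ - τ'|) ^ 2 *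
        zWeight κ s (b - 1 + ε) (τ', ξ) := by
  have hd := bracket_le_mul_bracket hT (τ' - κ * ξ) (τ - κ * ξ)
  have hl := bracket_le_div hT hT1 (τ + κ * ξ)
  have hl' := bracket_le_mul_div hT hT1 (τ + κ * ξ) (τ' + κ * ξ)
  rw [sub_sub_sub_cancel_right, abs_sub_comm] at hd
  rw [add_sub_add_right_eq_sub] at hl'
  set V := blurFactor T (bracket (τ - κ * ξ))
  set M := 1 + T * |τ + κ * ξ|
  set J := 1 + T * |τ - τ'|
  have hV : 0 < V := one_pos.trans_le (one_le_blurFactor hT (bracket_pos _))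
  have hM : 1 ≤ M := le_add_of_nonneg_right (by positivity)
  have hJ : 1 ≤ J := le_add_of_nonneg_right (by positivity)
  calc T * (zWeight κ s b (τ, ξ) / M)
      ≤ T * ((V * J) ^ (-s) * bracket (τ' - κ * ξ) ^ s * (M / T) ^ b / M) := by
        gcongr
        exact zWeight_le_mul
          (rpow_le_mul_rpow_of_le_mul (bracket_pos _) (by positivity) hd hs') hb hl
    _ ≤ V ^ (-s) * J ^ (-s) * bracket (τ' - κ * ξ) ^ s *
          (T ^ ε * (J ^ (-(b - 1 + ε)) * bracket (τ' + κ * ξ) ^ (b - 1 + ε))) := by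
        rw [mul_div_assoc, mul_left_comm, Real.mul_rpow (by positivity) (by positivity)]
        have := bracket_pos (τ' - κ * ξ)
        refine mul_le_mul_of_nonneg_left ((mul_rpow_div_le hε b hT hM).trans ?_) (by positivity)
        gcongr
        exact rpow_le_mul_rpow_of_le_mul (bracket_pos _) (by positivity) hl' (by linarith)
    _ = T ^ ε * V ^ (-s) * J ^ (-s - (b - 1 + ε)) * zWeight κ s (b - 1 + ε) (τ', ξ) := by
        rw [sub_eq_add_neg (-s), Real.rpow_add (one_pos.trans_le hJ), zWeight]; ring
    _ ≤ _ := by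
        have := zWeight_pos κ s (b - 1 + ε) (τ', ξ)
        gcongr
        rw [← Real.rpow_natCast]
        exact Real.rpow_le_rpow_of_exponent_le hJ (by push_cast; linarith)

/-! ### The kernel of a time cutoff -/

/-- The kernel `T (1 + T|ν|)⁻ⁿ`, of mass comparable to `1` if `2 ≤ n`. It dominates the Fourier
transform of a Schwartz function of `t / T`. -/
noncomputable def decayKernel (n : ℕ) (T ν : ℝ) : ℝ := T * ((1 + |T * ν|) ^ n)⁻¹

theorem decayKernel_nonneg (n : ℕ) {T : ℝ} (hT : 0 ≤ T) (ν : ℝ) : 0 ≤ decayKernel n T ν :=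
  mul_nonneg hT (by positivity)

theorem decayKernel_four_sq_le {T : ℝ} (hT : 0 ≤ T) (ν : ℝ) :
    decayKernel 4 T ν ^ 2 ≤ T * decayKernel 2 T ν := by
  have h1 : 1 ≤ 1 + |T * ν| := le_add_of_nonneg_right (abs_nonneg _)
  rw [decayKernel, mul_pow, sq, mul_assoc, decayKernel]
  gcongr
  rw [inv_pow, ← pow_mul]
  exact inv_anti₀ (by positivity) (pow_le_pow_right₀ h1 (by norm_num))

@[fun_prop]
theorem measurable_decayKernel (n : ℕ) (T : ℝ) : Measurable (decayKernel n T) := by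
  unfold decayKernel; fun_prop

theorem lintegral_ofReal_mul_comp_mul_sub {T : ℝ} (hT : 0 < T) (c : ℝ) {G : ℝ → ℝ≥0∞}
    (hG : Measurable G) : ∫⁻ x, ENNReal.ofReal T * G (T * (x - c)) = ∫⁻ x, G x := by
  rw [lintegral_sub_right_eq_self (fun x => ENNReal.ofReal T * G (T * x)) c]
  conv_rhs => rw [← Real.smul_map_volume_mul_left hT.ne']
  rw [lintegral_smul_measure, lintegral_map hG (by fun_prop), abs_of_pos hT, smul_eq_mul,
    lintegral_const_mul _ (by fun_prop)]

theorem integrableOn_Icc_abs_rpow {r : ℝ} (hr : -1 < r) :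
    IntegrableOn (fun y : ℝ => |y| ^ r) (Set.Icc (-1) 1) := by
  rw [← intervalIntegrable_iff_integrableOn_Icc_of_le (by norm_num)]
  refine intervalIntegrable_of_even (fun y => by rw [abs_neg]) fun x hx => ?_
  refine (intervalIntegral.intervalIntegrable_rpow' hr).congr fun y hy => ?_
  rw [Set.uIoc_of_le hx.le] at hy
  simp only [abs_of_pos hy.1]

theorem lintegral_one_add_abs_sq_inv_lt_top :
    ∫⁻ y : ℝ, ENNReal.ofReal (((1 + |y|) ^ 2)⁻¹) < ⊤ := by
  simpa [Real.rpow_neg, Real.rpow_ofNat, add_nonneg] using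
    finite_integral_one_add_norm (E := ℝ) (μ := volume) (r := 2) (by simp)

theorem one_add_inv_rpow_le {q y d : ℝ} (hq0 : 0 ≤ q) (hq1 : q ≤ 1) (hy : 0 < |y|) (hyd : |y| ≤ d) :
    (1 + d⁻¹) ^ q ≤ 2 + (Set.Icc (-1) 1).indicator (fun y => |y| ^ (-q)) y := by
  have hd : 0 < d := hy.trans_le hyd
  have hsub : (1 + d⁻¹) ^ q ≤ 1 + |y| ^ (-q) := by
    calc (1 + d⁻¹) ^ q ≤ (1 + |y|⁻¹) ^ q := by gcongr
      _ ≤ 1 ^ q + |y|⁻¹ ^ q := Real.rpow_add_le_add_rpow zero_le_one (by positivity) hq0 hq1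
      _ = 1 + |y| ^ (-q) := by rw [Real.one_rpow, Real.inv_rpow hy.le, Real.rpow_neg hy.le]
  by_cases h : y ∈ Set.Icc (-1 : ℝ) 1
  · rw [Set.indicator_of_mem h]
    linarith
  · rw [Set.indicator_of_notMem h]
    have hy1 : 1 ≤ |y| := by
      by_contra! hlt
      exact h (abs_le.1 hlt.le)
    linarith [Real.rpow_le_one_of_one_le_of_nonpos hy1 (neg_nonpos.2 hq0)]

theorem blurFactor_rpow_mul_decayKernel_le {q T : ℝ} (hq0 : 0 ≤ q) (hq1 : q ≤ 1) (hT : 0 < T)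
    {x c : ℝ} (hx : x ≠ c) (m : ℝ) :
    blurFactor T (bracket (x - c)) ^ q * decayKernel 2 T (x - m) ≤
      2 * decayKernel 2 T (x - m) +
        T * (Set.Icc (-1) 1).indicator (fun y => |y| ^ (-q)) (T * (x - c)) := by
  set f : ℝ → ℝ := (Set.Icc (-1) 1).indicator fun y => |y| ^ (-q)
  have hf : 0 ≤ f (T * (x - c)) := Set.indicator_nonneg (fun _ _ => by positivity) _
  have hk : decayKernel 2 T (x - m) ≤ T :=
    mul_le_of_le_one_right hT.le
      (inv_le_one_of_one_le₀ (one_le_pow₀ (le_add_of_nonneg_right (abs_nonneg _))))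
  have hblur : blurFactor T (bracket (x - c)) ^ q ≤ 2 + f (T * (x - c)) := by
    refine one_add_inv_rpow_le hq0 hq1 (abs_pos.2 (mul_ne_zero hT.ne' (sub_ne_zero.2 hx))) ?_
    rw [abs_mul, abs_of_pos hT]
    gcongr
    exact abs_le_bracket _
  calc _ ≤ (2 + f (T * (x - c))) * decayKernel 2 T (x - m) :=
        mul_le_mul_of_nonneg_right hblur (decayKernel_nonneg 2 hT.le _)
    _ = 2 * decayKernel 2 T (x - m) + decayKernel 2 T (x - m) * f (T * (x - c)) := by ring
    _ ≤ _ := by gcongr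

theorem exists_lintegral_blurFactor_rpow_mul_decayKernel_le {q : ℝ} (hq0 : 0 ≤ q) (hq : q < 1) :
    ∃ C : ℝ≥0, ∀ T : ℝ, 0 < T → ∀ c m : ℝ,
      ∫⁻ x, ENNReal.ofReal (blurFactor T (bracket (x - c)) ^ q) *
        ENNReal.ofReal (decayKernel 2 T (x - m)) ≤ C := by
  let f : ℝ → ℝ := (Set.Icc (-1) 1).indicator fun y => |y| ^ (-q)
  let p : ℝ → ℝ := fun y => ((1 + |y|) ^ 2)⁻¹
  have hf : Measurable f := Measurable.indicator (by fun_prop) measurableSet_Icc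
  have hf0 (y : ℝ) : 0 ≤ f y := Set.indicator_nonneg (fun _ _ => by positivity) y
  have hfi : ∫⁻ y, ENNReal.ofReal (f y) < ⊤ :=
    ((integrable_indicator_iff measurableSet_Icc).2
      (integrableOn_Icc_abs_rpow (by linarith))).lintegral_lt_top
  have hpi : ∫⁻ y, ENNReal.ofReal (p y) < ⊤ := lintegral_one_add_abs_sq_inv_lt_top
  refine ⟨(2 * (∫⁻ y, ENNReal.ofReal (p y)) + ∫⁻ y, ENNReal.ofReal (f y)).toNNReal,
    fun T hT c m => ?_⟩
  rw [ENNReal.coe_toNNReal (by finiteness)]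
  have hne : ∀ᵐ x : ℝ, x ≠ c := Measure.ae_ne volume c
  calc _ ≤ ∫⁻ x, 2 * (ENNReal.ofReal T * ENNReal.ofReal (p (T * (x - m)))) +
          ENNReal.ofReal T * ENNReal.ofReal (f (T * (x - c))) := by
        refine lintegral_mono_ae (hne.mono fun x hx => ?_)
        have hV := one_le_blurFactor hT (bracket_pos (x - c))
        rw [← ENNReal.ofReal_mul (by positivity), ← ENNReal.ofReal_mul hT.le,
          ← ENNReal.ofReal_mul hT.le, ← ENNReal.ofReal_ofNat 2, ← ENNReal.ofReal_mul two_pos.le,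
          ← ENNReal.ofReal_add (by positivity) (mul_nonneg hT.le (hf0 _))]
        exact ENNReal.ofReal_le_ofReal (blurFactor_rpow_mul_decayKernel_le hq0 hq.le hT hx m)
    _ = _ := by
        rw [lintegral_add_right _ (by fun_prop), lintegral_const_mul _ (by fun_prop),
          lintegral_ofReal_mul_comp_mul_sub hT m (G := fun y => ENNReal.ofReal (p y)) (by fun_prop),
          lintegral_ofReal_mul_comp_mul_sub hT c (G := fun y => ENNReal.ofReal (f y)) (by fun_prop)]

/-! ### Schur tests -/

theorem sq_lintegral_mul_le {α : Type*} [MeasurableSpace α] {μ : Measure α} {k f : α → ℝ≥0∞}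
    (hk : Measurable k) (hf : Measurable f) :
    (∫⁻ a, k a * f a ∂μ) ^ 2 ≤ (∫⁻ a, k a ∂μ) * ∫⁻ a, k a * f a ^ 2 ∂μ := by
  have h := pow_le_pow_left' (ENNReal.lintegral_mul_le_Lp_mul_Lq (μ.withDensity k)
    Real.HolderConjugate.two_two aemeasurable_one hf.aemeasurable) 2
  simp only [Pi.mul_apply, one_mul, ENNReal.one_rpow, mul_pow,
    ← ENNReal.rpow_mul_natCast] at h
  simpa [lintegral_withDensity_eq_lintegral_mul _ hk, hf, hf.pow_const 2] using h

section KernelOperator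

variable {α β : Type*} [MeasurableSpace α] [MeasurableSpace β] {μ : Measure α} {ν : Measure β}
  [SFinite μ] [SFinite ν] {v : α → ℝ≥0∞} {K : α → β → ℝ≥0∞} {g : β → ℝ≥0∞} {A B : ℝ≥0∞}

theorem lintegral_mul_lintegral_mul_le (hv : Measurable v) (hK : Measurable K.uncurry)
    (hg : Measurable g) (hA : ∀ y, ∫⁻ x, v x * K x y ∂μ ≤ A) :
    ∫⁻ x, v x * ∫⁻ y, K x y * g y ∂ν ∂μ ≤ A * ∫⁻ y, g y ∂ν := by
  have hKx (x : α) : Measurable (K x) := hK.of_uncurry_left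
  have hKy (y : β) : Measurable fun x => K x y := hK.of_uncurry_right
  calc ∫⁻ x, v x * ∫⁻ y, K x y * g y ∂ν ∂μ
      = ∫⁻ x, ∫⁻ y, v x * K x y * g y ∂ν ∂μ := by
        refine lintegral_congr fun x => ?_
        rw [← lintegral_const_mul _ (by fun_prop)]
        simp only [mul_assoc]
    _ = ∫⁻ y, ∫⁻ x, v x * K x y * g y ∂μ ∂ν := by
        refine lintegral_lintegral_swap (Measurable.aemeasurable ?_)
        change Measurable fun p : α × β => v p.1 * K.uncurry p * g p.2
        fun_prop
    _ ≤ ∫⁻ y, A * g y ∂ν := by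
        refine lintegral_mono fun y => ?_
        rw [lintegral_mul_const _ (by fun_prop)]
        gcongr
        exact hA y
    _ = _ := lintegral_const_mul _ hg

theorem lintegral_mul_sq_lintegral_mul_le (hv : Measurable v) (hK : Measurable K.uncurry)
    (hg : Measurable g) (hA : ∀ y, ∫⁻ x, v x * K x y ∂μ ≤ A) (hB : ∀ x, ∫⁻ y, K x y ∂ν ≤ B) :
    ∫⁻ x, v x * (∫⁻ y, K x y * g y ∂ν) ^ 2 ∂μ ≤ A * B * ∫⁻ y, g y ^ 2 ∂ν := by
  have hKx (x : α) : Measurable (K x) := hK.of_uncurry_left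
  have hA' (y : β) : ∫⁻ x, B * v x * K x y ∂μ ≤ B * A := by
    have : Measurable fun x => K x y := hK.of_uncurry_right
    simp only [mul_assoc]
    rw [lintegral_const_mul _ (by fun_prop)]
    gcongr
    exact hA y
  calc ∫⁻ x, v x * (∫⁻ y, K x y * g y ∂ν) ^ 2 ∂μ
      ≤ ∫⁻ x, B * v x * ∫⁻ y, K x y * g y ^ 2 ∂ν ∂μ := by
        refine lintegral_mono fun x => ?_
        rw [mul_comm B, mul_assoc]
        gcongr
        exact (sq_lintegral_mul_le (hKx x) hg).trans (mul_le_mul_left (hB x) _)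
    _ ≤ A * B * ∫⁻ y, g y ^ 2 ∂ν := by
        rw [mul_comm A]
        exact lintegral_mul_lintegral_mul_le (hv.const_mul B) hK (hg.pow_const 2) hA'

theorem lintegral_mul_sq_lintegral_mul_le_sq_lintegral (hv : Measurable v)
    (hK : Measurable K.uncurry) (hg : Measurable g) (hA : ∀ y, ∫⁻ x, v x * K x y ^ 2 ∂μ ≤ A) :
    ∫⁻ x, v x * (∫⁻ y, K x y * g y ∂ν) ^ 2 ∂μ ≤ A * (∫⁻ y, g y ∂ν) ^ 2 := by
  have hKx (x : α) : Measurable (K x) := hK.of_uncurry_left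
  have : Measurable fun x => ∫⁻ y, K x y ^ 2 * g y ∂ν := by
    refine Measurable.lintegral_prod_right' (f := fun p : α × β => K.uncurry p ^ 2 * g p.2) ?_
    fun_prop
  calc ∫⁻ x, v x * (∫⁻ y, K x y * g y ∂ν) ^ 2 ∂μ
      ≤ ∫⁻ x, (∫⁻ y, g y ∂ν) * (v x * ∫⁻ y, K x y ^ 2 * g y ∂ν) ∂μ := by
        refine lintegral_mono fun x => ?_
        rw [mul_left_comm]
        gcongr
        simpa only [mul_comm] using sq_lintegral_mul_le hg (hKx x)
    _ = (∫⁻ y, g y ∂ν) * ∫⁻ x, v x * ∫⁻ y, K x y ^ 2 * g y ∂ν ∂μ :=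
        lintegral_const_mul _ (by fun_prop)
    _ ≤ (∫⁻ y, g y ∂ν) * (A * ∫⁻ y, g y ∂ν) := by
        gcongr
        exact lintegral_mul_lintegral_mul_le (K := fun x y => K x y ^ 2) hv (hK.pow_const 2) hg hA
    _ = _ := by ring

end KernelOperator

/-! ### Estimates for the Fourier transform of the truncated solution -/

/-- The convolution of `u` with `decayKernel n T` in the time frequency. -/
noncomputable def decayConv (n : ℕ) (T : ℝ) (u : ℝ × ℝ → ℝ≥0∞) (p : ℝ × ℝ) : ℝ≥0∞ :=
  ∫⁻ τ, ENNReal.ofReal (decayKernel n T (p.1 - τ)) * u (τ, p.2)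

theorem measurable_decayConv (n : ℕ) (T : ℝ) {u : ℝ × ℝ → ℝ≥0∞} (hu : Measurable u) :
    Measurable (decayConv n T u) := by
  refine Measurable.lintegral_prod_right' (f := fun q : (ℝ × ℝ) × ℝ =>
    ENNReal.ofReal (decayKernel n T (q.1.1 - q.2)) * u (q.2, q.1.2)) ?_
  fun_prop

theorem eLpNorm_two_sq {α : Type*} [MeasurableSpace α] {μ : Measure α} (f : α → ℝ≥0∞) :
    eLpNorm f 2 μ ^ 2 = ∫⁻ x, f x ^ 2 ∂μ := by
  simpa using eLpNorm_nnreal_pow_eq_lintegral (f := f) (p := 2) (μ := μ) (by simp)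

theorem eLpNorm_two_sq_prod {f : ℝ × ℝ → ℝ≥0∞} (hf : Measurable f) :
    eLpNorm f 2 ^ 2 = ∫⁻ ξ, ∫⁻ τ, f (τ, ξ) ^ 2 := by
  rw [eLpNorm_two_sq, Measure.volume_eq_prod, lintegral_prod_symm' _ (hf.pow_const 2)]

theorem ofReal_blurFactor_rpow_sq {T : ℝ} (hT : 0 < T) (a r : ℝ) :
    ENNReal.ofReal (blurFactor T (bracket a) ^ r) ^ 2 =
      ENNReal.ofReal (blurFactor T (bracket a) ^ (2 * r)) := by
  have hV := one_le_blurFactor hT (bracket_pos a)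
  rw [← ENNReal.ofReal_pow (by positivity), ← Real.rpow_mul_natCast (by positivity), mul_comm r,
    Nat.cast_ofNat]

theorem exists_eLpNorm_mul_decayConv_two_le (κ : ℝ) {r : ℝ} (hr0 : 0 ≤ r) (hr : r < 1 / 2) :
    ∃ C : ℝ≥0, ∀ T : ℝ, 0 < T → ∀ {u : ℝ × ℝ → ℝ≥0∞}, Measurable u →
      eLpNorm (fun p => ENNReal.ofReal (blurFactor T (bracket (p.1 - κ * p.2)) ^ r) *
        decayConv 2 T u p) 2 ≤ C * eLpNorm u 2 := by
  obtain ⟨A, hA⟩ := exists_lintegral_blurFactor_rpow_mul_decayKernel_le (q := 2 * r)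
    (by linarith) (by linarith)
  obtain ⟨B, hB⟩ := exists_lintegral_blurFactor_rpow_mul_decayKernel_le le_rfl one_pos
  refine ⟨NNReal.sqrt (A * B), fun T hT u hu => (ENNReal.pow_le_pow_left_iff two_ne_zero).1 ?_⟩
  have hB' (τ : ℝ) : ∫⁻ τ', ENNReal.ofReal (decayKernel 2 T (τ - τ')) ≤ B := by
    rw [lintegral_sub_left_eq_self (fun ν => ENNReal.ofReal (decayKernel 2 T ν))]
    simpa using hB T hT 0 0
  rw [mul_pow, eLpNorm_two_sq_prod (by have := measurable_decayConv 2 T hu; fun_prop),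
    eLpNorm_two_sq_prod hu, ← ENNReal.coe_pow, NNReal.sq_sqrt, ENNReal.coe_mul,
    ← lintegral_const_mul' _ _ (by finiteness)]
  refine lintegral_mono fun ξ => ?_
  simp only [mul_pow, ofReal_blurFactor_rpow_sq hT]
  exact lintegral_mul_sq_lintegral_mul_le (by fun_prop) (by fun_prop) (by fun_prop)
    (hA T hT (κ * ξ)) hB'

theorem exists_eLpNorm_mul_decayConv_four_le (κ : ℝ) {r : ℝ} (hr0 : 0 ≤ r) (hr : r < 1 / 2) :
    ∃ C : ℝ≥0, ∀ T : ℝ, 0 < T → ∀ {u : ℝ × ℝ → ℝ≥0∞}, Measurable u →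
      eLpNorm (fun p => ENNReal.ofReal (blurFactor T (bracket (p.1 - κ * p.2)) ^ r) *
        decayConv 4 T u p) 2 ≤
      C * ENNReal.ofReal (T ^ (1 / 2 : ℝ)) * eLpNorm (fun ξ => ∫⁻ τ, u (τ, ξ)) 2 := by
  obtain ⟨A, hA⟩ := exists_lintegral_blurFactor_rpow_mul_decayKernel_le (q := 2 * r)
    (by linarith) (by linarith)
  refine ⟨NNReal.sqrt A, fun T hT u hu => (ENNReal.pow_le_pow_left_iff two_ne_zero).1 ?_⟩
  rw [mul_pow, mul_pow, eLpNorm_two_sq_prod (by have := measurable_decayConv 4 T hu; fun_prop),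
    eLpNorm_two_sq, ← ENNReal.coe_pow, NNReal.sq_sqrt, ← ENNReal.ofReal_pow (by positivity),
    ← Real.rpow_mul_natCast hT.le, Nat.cast_ofNat, div_mul_cancel₀ _ two_ne_zero, Real.rpow_one,
    ← lintegral_const_mul' _ _ (by finiteness)]
  refine lintegral_mono fun ξ => ?_
  simp only [mul_pow, ofReal_blurFactor_rpow_sq hT]
  refine lintegral_mul_sq_lintegral_mul_le_sq_lintegral (by fun_prop) (by fun_prop) (by fun_prop)
    fun τ' => ?_
  calc _ ≤ ∫⁻ τ, ENNReal.ofReal T *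
          (ENNReal.ofReal (blurFactor T (bracket (τ - κ * ξ)) ^ (2 * r)) *
            ENNReal.ofReal (decayKernel 2 T (τ - τ'))) := by
        refine lintegral_mono fun τ => ?_
        rw [mul_left_comm, ← ENNReal.ofReal_pow (decayKernel_nonneg 4 hT.le _),
          ← ENNReal.ofReal_mul hT.le]
        gcongr
        exact decayKernel_four_sq_le hT.le _
    _ ≤ A * ENNReal.ofReal T := by
        rw [lintegral_const_mul _ (by fun_prop), mul_comm]
        gcongr
        exact hA T hT (κ * ξ) τ'

theorem decayConv_mul_of_snd (n : ℕ) {T : ℝ} (c : ℝ → ℝ≥0∞) (hc : ∀ ξ, c ξ ≠ ⊤)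
    (u : ℝ × ℝ → ℝ≥0∞) (p : ℝ × ℝ) :
    decayConv n T (fun q => c q.2 * u q) p = c p.2 * decayConv n T u p := by
  rw [decayConv, decayConv, ← lintegral_const_mul' _ _ (hc p.2)]
  simp only [mul_left_comm]

theorem decayKernel_two_eq {T : ℝ} (hT : 0 ≤ T) (ν : ℝ) :
    decayKernel 2 T ν = (1 + T * |ν|) ^ 2 * decayKernel 4 T ν := by
  rw [decayKernel, decayKernel, abs_mul, abs_of_nonneg hT]
  have : 1 + T * |ν| ≠ 0 := by positivity
  field_simp

section Pointwise

variable {κ s b ε T : ℝ} {g f h : ℝ × ℝ → ℝ≥0∞}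

theorem zWeight_div_mul_decayConv_le (hκ : κ ≠ 0) (hs : -1 ≤ s) (hs' : s ≤ 0) (hb : 0 ≤ b)
    (hbs : b ≤ 1 + s) (hT : 0 < T) (hT1 : T ≤ 1) (g : ℝ × ℝ → ℝ≥0∞) (p : ℝ × ℝ) :
    ENNReal.ofReal (zWeight κ s b p / (1 + T * |p.1 + κ * p.2|)) * decayConv 4 T g p ≤
      ENNReal.ofReal (1 + |κ|⁻¹) * ENNReal.ofReal (T ^ (-b)) *
        (ENNReal.ofReal (blurFactor T (bracket (p.1 - κ * p.2)) ^ (-s)) *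
          decayConv 4 T (fun q => ENNReal.ofReal (bracket q.2 ^ s) * g q) p) := by
  have hξ : 0 ≤ bracket p.2 ^ s := Real.rpow_nonneg (bracket_pos _).le s
  rw [decayConv_mul_of_snd 4 (fun ξ => ENNReal.ofReal (bracket ξ ^ s))
      (fun _ => ENNReal.ofReal_ne_top),
    ← mul_assoc (ENNReal.ofReal (_ ^ (-s))), ← mul_assoc, mul_comm (ENNReal.ofReal (_ ^ (-s))),
    ← ENNReal.ofReal_mul hξ, ← ENNReal.ofReal_mul (by positivity),
    ← ENNReal.ofReal_mul (by positivity)]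
  gcongr
  exact zWeight_div_le hκ hs hs' hb hbs hT hT1 p

theorem mul_zWeight_div_mul_decayConv_le (hs : -1 ≤ s) (hs' : s ≤ 0) (hε : 0 ≤ ε) (hb : 0 ≤ b)
    (hbε : b ≤ 1 - ε) (hT : 0 < T) (hT1 : T ≤ 1) (f : ℝ × ℝ → ℝ≥0∞) (p : ℝ × ℝ) :
    ENNReal.ofReal (T * (zWeight κ s b p / (1 + T * |p.1 + κ * p.2|))) * decayConv 4 T f p ≤
      ENNReal.ofReal (T ^ ε) * (ENNReal.ofReal (blurFactor T (bracket (p.1 - κ * p.2)) ^ (-s)) *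
        decayConv 2 T (fun q => ENNReal.ofReal (zWeight κ s (b - 1 + ε) q) * f q) p) := by
  have hV := one_le_blurFactor hT (bracket_pos (p.1 - κ * p.2))
  have := zWeight_pos κ s b p
  rw [← mul_assoc, ← ENNReal.ofReal_mul (by positivity), decayConv, decayConv,
    ← lintegral_const_mul' _ _ ENNReal.ofReal_ne_top,
    ← lintegral_const_mul' _ _ ENNReal.ofReal_ne_top]
  refine lintegral_mono fun τ' => ?_
  have hk := decayKernel_nonneg 4 hT.le (p.1 - τ')
  rw [← mul_assoc, ← mul_assoc, ← mul_assoc, ← ENNReal.ofReal_mul' hk, mul_assoc (ENNReal.ofReal _),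
    ← ENNReal.ofReal_mul (decayKernel_nonneg 2 hT.le _), ← ENNReal.ofReal_mul (by positivity)]
  refine mul_le_mul_left (ENNReal.ofReal_le_ofReal ?_) _
  rw [decayKernel_two_eq hT.le]
  calc _ ≤ _ := mul_le_mul_of_nonneg_right
        (mul_zWeight_div_le hs hs' hε hb hbε hT hT1 p.1 τ' p.2) hk
    _ = _ := by ring

theorem zWeight_mul_le_of_transport {A : ℝ≥0∞} (hκ : κ ≠ 0) (hs : -1 ≤ s) (hs' : s ≤ 0)
    (hε : 0 ≤ ε) (hb : 0 ≤ b) (hbs : b ≤ 1 + s) (hbε : b ≤ 1 - ε) (hT : 0 < T) (hT1 : T ≤ 1)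
    {p : ℝ × ℝ} (hh : h p ≤ A * decayConv 4 T g p)
    (hlh : ENNReal.ofReal |p.1 + κ * p.2| * h p ≤
      A * (ENNReal.ofReal T⁻¹ * decayConv 4 T g p + decayConv 4 T f p)) :
    ENNReal.ofReal (zWeight κ s b p) * h p ≤
      2 * A * ENNReal.ofReal (1 + |κ|⁻¹) * ENNReal.ofReal (T ^ (-b)) *
          (ENNReal.ofReal (blurFactor T (bracket (p.1 - κ * p.2)) ^ (-s)) *
            decayConv 4 T (fun q => ENNReal.ofReal (bracket q.2 ^ s) * g q) p) +
        A * ENNReal.ofReal (T ^ ε) *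
          (ENNReal.ofReal (blurFactor T (bracket (p.1 - κ * p.2)) ^ (-s)) *
            decayConv 2 T (fun q => ENNReal.ofReal (zWeight κ s (b - 1 + ε) q) * f q) p) := by
  have hg := zWeight_div_mul_decayConv_le hκ hs hs' hb hbs hT hT1 g p
  have hf := mul_zWeight_div_mul_decayConv_le (κ := κ) hs hs' hε hb hbε hT hT1 f p
  set M := 1 + T * |p.1 + κ * p.2|
  have hM : 0 < M := by positivity
  have hW := (zWeight_pos κ s b p).le
  have hMh : ENNReal.ofReal M * h p ≤
      A * (2 * decayConv 4 T g p + ENNReal.ofReal T * decayConv 4 T f p) := by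
    calc ENNReal.ofReal M * h p
        = h p + ENNReal.ofReal T * (ENNReal.ofReal |p.1 + κ * p.2| * h p) := by
          rw [ENNReal.ofReal_add one_pos.le (by positivity), ENNReal.ofReal_mul hT.le,
            ENNReal.ofReal_one]
          ring
      _ ≤ A * decayConv 4 T g p + ENNReal.ofReal T *
            (A * (ENNReal.ofReal T⁻¹ * decayConv 4 T g p + decayConv 4 T f p)) := by gcongr
      _ = A * (decayConv 4 T g p + ENNReal.ofReal T * ENNReal.ofReal T⁻¹ * decayConv 4 T g p +
            ENNReal.ofReal T * decayConv 4 T f p) := by ring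
      _ = _ := by
          rw [← ENNReal.ofReal_mul hT.le, mul_inv_cancel₀ hT.ne', ENNReal.ofReal_one, one_mul,
            two_mul]
  calc ENNReal.ofReal (zWeight κ s b p) * h p
      = ENNReal.ofReal (zWeight κ s b p / M) * (ENNReal.ofReal M * h p) := by
        rw [← mul_assoc, ← ENNReal.ofReal_mul (by positivity), div_mul_cancel₀ _ hM.ne']
    _ ≤ ENNReal.ofReal (zWeight κ s b p / M) *
          (A * (2 * decayConv 4 T g p + ENNReal.ofReal T * decayConv 4 T f p)) := by gcongr
    _ = 2 * A * (ENNReal.ofReal (zWeight κ s b p / M) * decayConv 4 T g p) +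
          A * (ENNReal.ofReal (T * (zWeight κ s b p / M)) * decayConv 4 T f p) := by
        rw [ENNReal.ofReal_mul hT.le]; ring
    _ ≤ _ := by
        rw [mul_assoc (2 * (A : ℝ≥0∞)), mul_assoc (2 * (A : ℝ≥0∞)), mul_assoc (A : ℝ≥0∞)]
        gcongr

end Pointwise

theorem eLpNorm_two_le_of_ae_le_add {α : Type*} [MeasurableSpace α] {μ : Measure α}
    {h u v : α → ℝ≥0∞} {a c : ℝ≥0∞} (hu : Measurable u) (hv : Measurable v)
    (hh : ∀ᵐ x ∂μ, h x ≤ a * u x + c * v x) :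
    eLpNorm h 2 μ ≤ a * eLpNorm u 2 μ + c * eLpNorm v 2 μ := by
  have hconst {u : α → ℝ≥0∞} (hu : Measurable u) (a : ℝ≥0∞) :
      eLpNorm (fun x => a * u x) 2 μ ≤ a * eLpNorm u 2 μ :=
    eLpNorm_le_mul_eLpNorm_of_ae_le_mul'' 2 hu.aestronglyMeasurable (by simp)
  calc eLpNorm h 2 μ ≤ eLpNorm ((fun x => a * u x) + fun x => c * v x) 2 μ :=
        eLpNorm_mono_enorm_ae hh
    _ ≤ eLpNorm (fun x => a * u x) 2 μ + eLpNorm (fun x => c * v x) 2 μ :=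
        eLpNorm_add_le (hu.const_mul a).aestronglyMeasurable (hv.const_mul c).aestronglyMeasurable
          (by norm_num)
    _ ≤ _ := add_le_add (hconst hu a) (hconst hv c)

theorem exists_eLpNorm_zWeight_mul_le {κ s b ε : ℝ} (hκ : κ ≠ 0) (hs : -1 / 2 < s) (hs' : s ≤ 0)
    (hε : 0 ≤ ε) (hb : 0 ≤ b) (hbs : b ≤ 1 + s) (hbε : b ≤ 1 - ε) (A : ℝ≥0) :
    ∃ C : ℝ≥0, ∀ T : ℝ, 0 < T → T ≤ 1 → ∀ {g f h : ℝ × ℝ → ℝ≥0∞}, Measurable g → Measurable f →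
      (∀ p, h p ≤ A * decayConv 4 T g p) →
      (∀ᵐ p, ENNReal.ofReal |p.1 + κ * p.2| * h p ≤
        A * (ENNReal.ofReal T⁻¹ * decayConv 4 T g p + decayConv 4 T f p)) →
      eLpNorm (fun p => ENNReal.ofReal (zWeight κ s b p) * h p) 2 ≤
        C * (ENNReal.ofReal (T ^ (1 / 2 - b)) *
            eLpNorm (fun ξ => ∫⁻ τ, ENNReal.ofReal (bracket ξ ^ s) * g (τ, ξ)) 2 +
          ENNReal.ofReal (T ^ ε) *
            eLpNorm (fun p => ENNReal.ofReal (zWeight κ s (b - 1 + ε) p) * f p) 2) := by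
  obtain ⟨B, hB⟩ := exists_eLpNorm_mul_decayConv_four_le κ (neg_nonneg.2 hs') (by linarith)
  obtain ⟨D, hD⟩ := exists_eLpNorm_mul_decayConv_two_le κ (neg_nonneg.2 hs') (by linarith)
  set L := ENNReal.ofReal (1 + |κ|⁻¹)
  have hL : L ≠ ⊤ := ENNReal.ofReal_ne_top
  refine ⟨(2 * A * L * B + A * D).toNNReal, fun T hT hT1 g f h hg hf hh hlh => ?_⟩
  have hgs : Measurable fun q : ℝ × ℝ => ENNReal.ofReal (bracket q.2 ^ s) * g q := by fun_prop
  have hfw : Measurable fun q => ENNReal.ofReal (zWeight κ s (b - 1 + ε) q) * f q := by fun_prop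
  have hV : Measurable fun p : ℝ × ℝ =>
      ENNReal.ofReal (blurFactor T (bracket (p.1 - κ * p.2)) ^ (-s)) := by fun_prop
  have hTb : ENNReal.ofReal (T ^ (1 / 2 - b)) =
      ENNReal.ofReal (T ^ (-b)) * ENNReal.ofReal (T ^ (1 / 2 : ℝ)) := by
    rw [← ENNReal.ofReal_mul (by positivity), ← Real.rpow_add hT, neg_add_eq_sub]
  refine (eLpNorm_two_le_of_ae_le_add (hV.mul (measurable_decayConv 4 T hgs))
    (hV.mul (measurable_decayConv 2 T hfw)) (hlh.mono fun p hp => zWeight_mul_le_of_transport hκ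
      (by linarith) hs' hε hb hbs hbε hT hT1 (hh p) hp)).trans ?_
  refine (add_le_add (mul_le_mul_right (hB T hT hgs) _) (mul_le_mul_right (hD T hT hfw) _)).trans ?_
  rw [ENNReal.coe_toNNReal (by finiteness), hTb]
  generalize eLpNorm (fun ξ => ∫⁻ τ, ENNReal.ofReal (bracket ξ ^ s) * g (τ, ξ)) 2 volume = Y
  generalize eLpNorm (_ : ℝ × ℝ → ℝ≥0∞) 2 volume = Z
  calc _ = 2 * A * L * B * (ENNReal.ofReal (T ^ (-b)) * ENNReal.ofReal (T ^ (1 / 2 : ℝ)) * Y) +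
          A * D * (ENNReal.ofReal (T ^ ε) * Z) := by ring
    _ ≤ _ := by
        rw [mul_add]
        gcongr
        · exact le_self_add
        · exact le_add_self

/-! ### Multiplication by a function of time -/

theorem pt_eq (p : ℝ × ℝ) : pt p.1 p.2 = (WithLp.prodContinuousLinearEquiv 2 ℝ ℝ ℝ).symm p := rfl

@[fun_prop]
theorem continuous_pt : Continuous fun p : ℝ × ℝ => pt p.1 p.2 :=
  (WithLp.prodContinuousLinearEquiv 2 ℝ ℝ ℝ).symm.continuous

theorem inner_pt (x : Spacetime) (τ ξ : ℝ) : inner ℝ x (pt τ ξ) = x.fst * τ + x.snd * ξ := by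
  simp [pt, WithLp.prod_inner_apply, mul_comm]

theorem norm_le_norm_pt (p : ℝ × ℝ) : ‖p‖ ≤ ‖pt p.1 p.2‖ := by
  have h : ‖pt p.1 p.2‖ = Real.sqrt (‖p.1‖ ^ 2 + ‖p.2‖ ^ 2) := WithLp.prod_norm_eq_of_L2 _
  rw [h, Prod.norm_def]
  exact max_le (Real.le_sqrt_of_sq_le (le_add_of_nonneg_right (sq_nonneg _)))
    (Real.le_sqrt_of_sq_le (le_add_of_nonneg_left (sq_nonneg _)))

theorem one_add_norm_le_mul (p : ℝ × ℝ) (ν : ℝ) :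
    1 + ‖p‖ ≤ (1 + ‖pt (p.1 + ν) p.2‖) * (1 + |ν|) := by
  have hsub : ‖p‖ ≤ ‖pt (p.1 + ν) p.2‖ + |ν| := by
    calc ‖p‖ = ‖((p.1 + ν, p.2) : ℝ × ℝ) - (ν, 0)‖ := by simp
      _ ≤ ‖((p.1 + ν, p.2) : ℝ × ℝ)‖ + ‖((ν, 0) : ℝ × ℝ)‖ := norm_sub_le _ _
      _ ≤ _ := by
        gcongr
        · exact norm_le_norm_pt (p.1 + ν, p.2)
        · simp [Prod.norm_def]
  nlinarith [abs_nonneg ν, norm_nonneg (pt (p.1 + ν) p.2)]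

section Schwartz

variable {V E : Type*} [NormedAddCommGroup V] [NormedAddCommGroup E]

theorem exists_norm_le_mul_inv_one_add_norm_pow [NormedSpace ℝ V] [NormedSpace ℝ E]
    (φ : 𝓢(V, E)) (N : ℕ) : ∃ C : ℝ≥0, ∀ x, ‖φ x‖ ≤ C * ((1 + ‖x‖) ^ N)⁻¹ := by
  refine ⟨⟨2 ^ N * ((Finset.Iic (N, 0)).sup fun m => SchwartzMap.seminorm ℝ m.1 m.2) φ,
    by positivity⟩, fun x => ?_⟩
  have h := SchwartzMap.one_add_le_sup_seminorm_apply (𝕜 := ℝ) (m := (N, 0)) le_rfl le_rfl φ x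
  rw [norm_iteratedFDeriv_zero] at h
  rwa [← div_eq_mul_inv, le_div_iff₀ (by positivity), mul_comm]

theorem schwartzMap_eq_integral_fourier [InnerProductSpace ℝ V] [FiniteDimensional ℝ V]
    [MeasurableSpace V] [BorelSpace V] [NormedSpace ℂ E] [CompleteSpace E] (φ : 𝓢(V, E)) (x : V) :
    φ x = ∫ v, 𝐞 (inner ℝ v x) • 𝓕 φ v := by
  conv_lhs => rw [← FourierTransform.fourierInv_fourier_eq (F := 𝓢(V, E)) φ]
  rw [SchwartzMap.fourierInv_coe, Real.fourierInv_eq]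

end Schwartz

theorem hasTemperateGrowth_comp_fst {η : ℝ → ℂ} (hη : η.HasTemperateGrowth) :
    (fun p : Spacetime => η p.fst).HasTemperateGrowth :=
  hη.comp (WithLp.fstL 2 ℝ ℝ ℝ).hasTemperateGrowth

/-- The product of the tempered distribution `u` with the function `(t, x) ↦ η t`. -/
noncomputable def timeMul (η : ℝ → ℂ) (u : 𝓢'(Spacetime, ℂ)) : 𝓢'(Spacetime, ℂ) :=
  TemperedDistribution.smulLeftCLM ℂ (fun p : Spacetime => η p.fst) u

theorem timeMul_timeMul {η ζ : ℝ → ℂ} (hη : η.HasTemperateGrowth) (hζ : ζ.HasTemperateGrowth)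
    (u : 𝓢'(Spacetime, ℂ)) : timeMul η (timeMul ζ u) = timeMul (ζ * η) u :=
  TemperedDistribution.smulLeftCLM_smulLeftCLM_apply (hasTemperateGrowth_comp_fst hζ)
    (hasTemperateGrowth_comp_fst hη) u

theorem fourierInv_smulLeftCLM_fourier (χ : 𝓢(ℝ, ℂ)) (φ : 𝓢(Spacetime, ℂ)) (τ ξ : ℝ) :
    𝓕⁻ (SchwartzMap.smulLeftCLM ℂ (fun p : Spacetime => χ p.fst) (𝓕 φ)) (pt τ ξ) =
      ∫ ν, 𝓕 χ ν * φ (pt (τ + ν) ξ) := by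
  let H : Spacetime → ℝ → ℂ := fun x ν =>
    𝐞 (inner ℝ x (pt (τ + ν) ξ)) • (𝓕 φ x * 𝓕 χ ν)
  have hH : Integrable (Function.uncurry H) (volume.prod volume) := by
    have hcont : Continuous fun z : Spacetime × ℝ => inner ℝ z.1 (pt (τ + z.2) ξ) :=
      continuous_fst.inner (continuous_pt.comp (by fun_prop : Continuous fun z : Spacetime × ℝ =>
        (τ + z.2, ξ)))
    refine (((𝓕 φ).integrable).mul_prod (𝓕 χ).integrable).mono ?_ (.of_forall fun z => by
      simp [H, Function.uncurry])
    exact ((Real.continuous_fourierChar.comp hcont).smul (((𝓕 φ).continuous.comp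
      continuous_fst).mul ((𝓕 χ).continuous.comp continuous_snd))).aestronglyMeasurable
  have hchar (x : Spacetime) (ν : ℝ) : 𝐞 (inner ℝ x (pt (τ + ν) ξ)) =
      𝐞 (inner ℝ x (pt τ ξ)) * 𝐞 (inner ℝ ν x.fst) := by
    rw [← AddChar.map_add_eq_mul, inner_pt, inner_pt]
    congr 1
    simp only [RCLike.inner_apply, conj_trivial]
    ring
  calc _ = ∫ x, 𝐞 (inner ℝ x (pt τ ξ)) • (χ x.fst * 𝓕 φ x) := by
        rw [SchwartzMap.fourierInv_coe, Real.fourierInv_eq]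
        simp only [SchwartzMap.smulLeftCLM_apply_apply
          (hasTemperateGrowth_comp_fst χ.hasTemperateGrowth), smul_eq_mul]
    _ = ∫ x, ∫ ν, H x ν := by
        refine integral_congr_ae (.of_forall fun x => ?_)
        simp only [H, hchar, Circle.smul_def, smul_eq_mul, Circle.coe_mul]
        rw [schwartzMap_eq_integral_fourier χ, ← integral_mul_const, ← integral_const_mul]
        refine integral_congr_ae (.of_forall fun ν => ?_)
        simp only [Circle.smul_def, smul_eq_mul]
        ring
    _ = ∫ ν, ∫ x, H x ν := integral_integral_swap hH
    _ = _ := by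
        refine integral_congr_ae (.of_forall fun ν => ?_)
        simp only [H, mul_comm (𝓕 φ _), ← mul_smul_comm]
        rw [schwartzMap_eq_integral_fourier φ, integral_const_mul]

theorem exists_norm_mul_comp_pt_le (k : 𝓢(ℝ, ℂ)) (φ : 𝓢(Spacetime, ℂ)) (N : ℕ) :
    ∃ C : ℝ≥0, ∀ (p : ℝ × ℝ) (ν : ℝ),
      ‖k ν * φ (pt (p.1 + ν) p.2)‖ ≤ C * ((1 + |ν|) ^ 2)⁻¹ * ((1 + ‖p‖) ^ N)⁻¹ := by
  obtain ⟨A, hA⟩ := exists_norm_le_mul_inv_one_add_norm_pow k (N + 2)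
  obtain ⟨B, hB⟩ := exists_norm_le_mul_inv_one_add_norm_pow φ N
  refine ⟨A * B, fun p ν => ?_⟩
  have hshift : ((1 + ‖pt (p.1 + ν) p.2‖) ^ N)⁻¹ ≤ (1 + |ν|) ^ N * ((1 + ‖p‖) ^ N)⁻¹ := by
    rw [inv_le_comm₀ (by positivity) (by positivity), mul_inv, inv_inv,
      inv_mul_le_iff₀ (by positivity), mul_comm, ← mul_pow]
    exact pow_le_pow_left₀ (by positivity) (one_add_norm_le_mul p ν) N
  calc ‖k ν * φ (pt (p.1 + ν) p.2)‖
      ≤ A * ((1 + |ν|) ^ (N + 2))⁻¹ * (B * ((1 + |ν|) ^ N * ((1 + ‖p‖) ^ N)⁻¹)) := by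
        rw [norm_mul]
        gcongr
        · exact hA ν
        · exact (hB _).trans (by gcongr)
    _ = _ := by
        push_cast
        field_simp
        ring

/-- Integrability against the reciprocal of a polynomial, which makes `g` define a tempered
distribution. -/
def TemperedIntegrable (g : ℝ × ℝ → ℂ) : Prop :=
  ∃ N : ℕ, ∫⁻ p : ℝ × ℝ, ENNReal.ofReal ((1 + ‖p‖) ^ N)⁻¹ * ‖g p‖ₑ < ⊤

theorem TemperedIntegrable.integrable_mul_comp_pt {g : ℝ × ℝ → ℂ} (hgt : TemperedIntegrable g)
    (hg : Measurable g) (k : 𝓢(ℝ, ℂ)) (φ : 𝓢(Spacetime, ℂ)) :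
    Integrable fun z : ℝ × ℝ × ℝ => k z.1 * φ (pt (z.2.1 + z.1) z.2.2) * g z.2 := by
  obtain ⟨N, hN⟩ := hgt
  obtain ⟨C, hC⟩ := exists_norm_mul_comp_pt_le k φ N
  have hk : Integrable fun ν : ℝ => (C : ℝ) * ((1 + |ν|) ^ 2)⁻¹ := by
    refine Integrable.const_mul ⟨Measurable.aestronglyMeasurable (by fun_prop), ?_⟩ _
    rw [hasFiniteIntegral_iff_ofReal (.of_forall fun ν => by positivity)]
    exact lintegral_one_add_abs_sq_inv_lt_top
  have hgN : Integrable fun p : ℝ × ℝ => ((1 + ‖p‖) ^ N)⁻¹ * ‖g p‖ := by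
    refine ⟨by fun_prop, ?_⟩
    rw [hasFiniteIntegral_iff_ofReal (.of_forall fun p => by positivity)]
    simpa only [ENNReal.ofReal_mul (inv_nonneg.2 (pow_nonneg (add_nonneg zero_le_one
      (norm_nonneg _)) N)), ofReal_norm] using hN
  have hφ : Continuous fun z : ℝ × ℝ × ℝ => φ (pt (z.2.1 + z.1) z.2.2) :=
    φ.continuous.comp (continuous_pt.comp
      (by fun_prop : Continuous fun z : ℝ × ℝ × ℝ => (z.2.1 + z.1, z.2.2)))
  refine (hk.mul_prod hgN).mono' ?_ (.of_forall fun z => ?_)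
  · have := k.continuous.measurable
    have := hφ.measurable
    exact Measurable.aestronglyMeasurable (by fun_prop)
  · rw [norm_mul, ← mul_assoc]
    gcongr
    exact hC z.2 z.1

/-- The convolution of `g` with `k` in the time frequency. -/
noncomputable def freqConv (k : ℝ → ℂ) (g : ℝ × ℝ → ℂ) (p : ℝ × ℝ) : ℂ :=
  ∫ ν, k ν * g (p.1 - ν, p.2)

theorem enorm_freqConv_le {A : ℝ≥0∞} (hA : A ≠ ⊤) {n : ℕ} {T : ℝ} {k : ℝ → ℂ}
    (hk : ∀ ν, ‖k ν‖ₑ ≤ A * ENNReal.ofReal (decayKernel n T ν)) (g : ℝ × ℝ → ℂ) (p : ℝ × ℝ) :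
    ‖freqConv k g p‖ₑ ≤ A * decayConv n T (fun q => ‖g q‖ₑ) p := by
  calc ‖freqConv k g p‖ₑ ≤ ∫⁻ ν, ‖k ν * g (p.1 - ν, p.2)‖ₑ := enorm_integral_le_lintegral_enorm _
    _ ≤ ∫⁻ ν, A * (ENNReal.ofReal (decayKernel n T ν) * ‖g (p.1 - ν, p.2)‖ₑ) := by
        refine lintegral_mono fun ν => ?_
        rw [enorm_mul, ← mul_assoc]
        gcongr
        exact hk ν
    _ = A * ∫⁻ ν, ENNReal.ofReal (decayKernel n T ν) * ‖g (p.1 - ν, p.2)‖ₑ :=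
        lintegral_const_mul' _ _ hA
    _ = _ := by
        rw [decayConv, ← lintegral_sub_left_eq_self (fun ν => ENNReal.ofReal (decayKernel n T ν) *
          ‖g (p.1 - ν, p.2)‖ₑ) p.1]
        simp only [sub_sub_cancel]

theorem stronglyMeasurable_freqConv {k : ℝ → ℂ} (hk : Measurable k) {g : ℝ × ℝ → ℂ}
    (hg : Measurable g) : StronglyMeasurable (freqConv k g) := by
  have h : Measurable fun z : (ℝ × ℝ) × ℝ => k z.2 * g (z.1.1 - z.2, z.1.2) := by fun_prop
  exact h.stronglyMeasurable.integral_prod_right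

theorem measurePreserving_shear :
    MeasurePreserving (fun z : ℝ × ℝ × ℝ => (z.1, (z.2.1 - z.1, z.2.2))) volume volume :=
  (MeasurePreserving.id volume).skew_product (μa := volume) (μc := volume)
    (g := fun (ν : ℝ) (p : ℝ × ℝ) => (p.1 - ν, p.2)) (by fun_prop) (.of_forall fun ν => by
      simpa [Prod.sub_def] using (measurePreserving_sub_right volume ((ν, 0) : ℝ × ℝ)).map_eq)

theorem integrable_mul_freqConv_and_integral_eq {k : ℝ → ℂ} {Φ g : ℝ × ℝ → ℂ}
    (h : Integrable fun z : ℝ × ℝ × ℝ => k z.1 * Φ (z.2.1 + z.1, z.2.2) * g z.2) :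
    Integrable (fun p => Φ p * freqConv k g p) ∧
      ∫ p, Φ p * freqConv k g p = ∫ p : ℝ × ℝ, (∫ ν, k ν * Φ (p.1 + ν, p.2)) * g p := by
  have h' : Integrable fun z : ℝ × ℝ × ℝ => k z.1 * Φ z.2 * g (z.2.1 - z.1, z.2.2) := by
    simpa [Function.comp_def] using measurePreserving_shear.integrable_comp_of_integrable h
  have hconv (p : ℝ × ℝ) :
      Φ p * freqConv k g p = ∫ ν, k ν * Φ p * g (p.1 - ν, p.2) := by
    rw [freqConv, ← integral_const_mul]
    exact integral_congr_ae (.of_forall fun ν => by ring)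
  simp only [hconv, ← integral_mul_const]
  refine ⟨h'.integral_prod_right, ?_⟩
  rw [← integral_prod_symm _ h', ← integral_prod_symm _ h]
  rw [← measurePreserving_shear.map_eq] at h
  have hmap := integral_map measurePreserving_shear.measurable.aemeasurable h.aestronglyMeasurable
  rw [measurePreserving_shear.map_eq] at hmap
  simp only [sub_add_cancel] at hmap
  exact hmap.symm

protected theorem HasFourierDensity.timeMul {u : 𝓢'(Spacetime, ℂ)} {g : ℝ × ℝ → ℂ}
    (hu : HasFourierDensity u g) (hg : Measurable g) (hgt : TemperedIntegrable g) (χ : 𝓢(ℝ, ℂ)) :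
    HasFourierDensity (timeMul χ u) (freqConv (𝓕 χ : 𝓢(ℝ, ℂ)) g) := by
  refine ⟨(stronglyMeasurable_freqConv (𝓕 χ).continuous.measurable hg).aestronglyMeasurable,
    fun φ => ?_⟩
  have hφ := integrable_mul_freqConv_and_integral_eq (Φ := fun p => φ (pt p.1 p.2))
    (hgt.integrable_mul_comp_pt hg (𝓕 χ) φ)
  refine ⟨hφ.1, ?_⟩
  set χφ := 𝓕⁻ (SchwartzMap.smulLeftCLM ℂ (fun p : Spacetime => χ p.fst) (𝓕 φ)) with hχφ
  calc 𝓕 (timeMul χ u) φ = 𝓕 u χφ := by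
        rw [TemperedDistribution.fourier_apply, TemperedDistribution.fourier_apply, hχφ,
          FourierTransform.fourier_fourierInv_eq, timeMul,
          TemperedDistribution.smulLeftCLM_apply_apply]
    _ = ∫ p : ℝ × ℝ, χφ (pt p.1 p.2) * g p := (hu.2 χφ).2
    _ = _ := by
        simp only [hχφ, fourierInv_smulLeftCLM_fourier]
        exact hφ.2.symm

/-! ### Fourier densities and the transport equation -/

theorem HasFourierDensity.add {u v : 𝓢'(Spacetime, ℂ)} {g h : ℝ × ℝ → ℂ}
    (hu : HasFourierDensity u g) (hv : HasFourierDensity v h) :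
    HasFourierDensity (u + v) (g + h) := by
  refine ⟨hu.1.add hv.1, fun φ => ?_⟩
  obtain ⟨hgi, hge⟩ := hu.2 φ
  obtain ⟨hhi, hhe⟩ := hv.2 φ
  simp only [Pi.add_apply, mul_add]
  refine ⟨hgi.add hhi, ?_⟩
  rw [integral_add hgi hhi, ← hge, ← hhe, FourierTransform.fourier_add]
  rfl

theorem HasFourierDensity.congr_ae {u : 𝓢'(Spacetime, ℂ)} {g h : ℝ × ℝ → ℂ}
    (hu : HasFourierDensity u g) (hgh : g =ᵐ[volume] h) : HasFourierDensity u h := by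
  refine ⟨hu.1.congr hgh, fun φ => ?_⟩
  have hφ : (fun p : ℝ × ℝ => φ (pt p.1 p.2) * g p) =ᵐ[volume]
      fun p : ℝ × ℝ => φ (pt p.1 p.2) * h p := hgh.mono fun p hp => congrArg _ hp
  exact ⟨(hu.2 φ).1.congr hφ, (hu.2 φ).2.trans (integral_congr_ae hφ)⟩

theorem exists_schwartzMap_comp_pt_eq {χ : ℝ × ℝ → ℝ} (hχ : ContDiff ℝ ∞ χ)
    (hχ' : HasCompactSupport χ) : ∃ φ : 𝓢(Spacetime, ℂ), ∀ p : ℝ × ℝ, φ (pt p.1 p.2) = χ p := by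
  have hsmooth : ContDiff ℝ ∞ fun p => (χ p : ℂ) := Complex.ofRealCLM.contDiff.comp hχ
  have hcompact : HasCompactSupport fun p => (χ p : ℂ) :=
    hχ'.comp_left (g := fun x : ℝ => (x : ℂ)) Complex.ofReal_zero
  refine ⟨SchwartzMap.compCLMOfContinuousLinearEquiv ℂ (WithLp.prodContinuousLinearEquiv 2 ℝ ℝ ℝ)
    (hcompact.toSchwartzMap hsmooth), fun p => ?_⟩
  rw [pt_eq]
  simp

theorem locallyIntegrable_of_forall_schwartzMap {g : ℝ × ℝ → ℂ}
    (hg : ∀ φ : 𝓢(Spacetime, ℂ), Integrable fun p : ℝ × ℝ => φ (pt p.1 p.2) * g p) :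
    LocallyIntegrable g := by
  intro x
  let χ : ContDiffBump x := ⟨1, 2, one_pos, one_lt_two⟩
  obtain ⟨φ, hφ⟩ := exists_schwartzMap_comp_pt_eq χ.contDiff χ.hasCompactSupport
  refine ⟨Metric.closedBall x 1, Metric.closedBall_mem_nhds x one_pos,
    (hg φ).integrableOn.congr_fun (fun p hp => ?_) Metric.isClosed_closedBall.measurableSet⟩
  simp only [hφ, χ.one_of_mem_closedBall hp, Complex.ofReal_one, one_mul]

theorem ae_eq_of_forall_schwartzMap {g h : ℝ × ℝ → ℂ}
    (hg : ∀ φ : 𝓢(Spacetime, ℂ), Integrable fun p : ℝ × ℝ => φ (pt p.1 p.2) * g p)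
    (hh : ∀ φ : 𝓢(Spacetime, ℂ), Integrable fun p : ℝ × ℝ => φ (pt p.1 p.2) * h p)
    (hgh : ∀ φ : 𝓢(Spacetime, ℂ), ∫ p : ℝ × ℝ, φ (pt p.1 p.2) * g p =
      ∫ p : ℝ × ℝ, φ (pt p.1 p.2) * h p) : g =ᵐ[volume] h := by
  refine ae_eq_of_integral_contDiff_smul_eq (locallyIntegrable_of_forall_schwartzMap hg)
    (locallyIntegrable_of_forall_schwartzMap hh) fun χ hχ hχ' => ?_
  obtain ⟨φ, hφ⟩ := exists_schwartzMap_comp_pt_eq hχ hχ'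
  simpa only [hφ, Complex.real_smul] using hgh φ

theorem HasFourierDensity.ae_eq {u : 𝓢'(Spacetime, ℂ)} {g h : ℝ × ℝ → ℂ}
    (hg : HasFourierDensity u g) (hh : HasFourierDensity u h) : g =ᵐ[volume] h :=
  ae_eq_of_forall_schwartzMap (fun φ => (hg.2 φ).1) (fun φ => (hh.2 φ).1)
    fun φ => (hg.2 φ).2.symm.trans (hh.2 φ).2

theorem HasFourierDensity.lineDeriv {u : 𝓢'(Spacetime, ℂ)} {g : ℝ × ℝ → ℂ}
    (hu : HasFourierDensity u g) (v : Spacetime) :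
    HasFourierDensity (∂_{v} u)
      fun p => 2 * Real.pi * Complex.I * (inner ℝ (pt p.1 p.2) v : ℝ) * g p := by
  have hmul (φ : 𝓢(Spacetime, ℂ)) (p : ℝ × ℝ) :
      φ (pt p.1 p.2) * (2 * Real.pi * Complex.I * (inner ℝ (pt p.1 p.2) v : ℝ) * g p) =
        ((2 * Real.pi * Complex.I) • SchwartzMap.smulLeftCLM ℂ (inner ℝ · v) φ) (pt p.1 p.2) *
          g p := by
    rw [smul_apply, SchwartzMap.smulLeftCLM_apply_apply (by fun_prop), Complex.real_smul,
      smul_eq_mul]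
    ring
  refine ⟨Continuous.aestronglyMeasurable (by fun_prop) |>.mul hu.1, fun φ => ?_⟩
  simp only [hmul]
  refine ⟨(hu.2 _).1, ?_⟩
  have hgrowth : (fun x : Spacetime => inner ℝ x v).HasTemperateGrowth := by fun_prop
  rw [← (hu.2 _).2, ← SchwartzMap.smulLeftCLM_ofReal ℂ hgrowth, map_smul,
    TemperedDistribution.fourier_lineDerivOp_eq]
  rfl

theorem solvesTransport_iff {κ : ℝ} {ψ F : 𝓢'(Spacetime, ℂ)} :
    SolvesTransport κ ψ F ↔ ∂_{pt 1 κ} ψ = F := by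
  have h : pt 1 κ = pt 1 0 + κ • pt 0 1 := by simp [pt, ← WithLp.toLp_smul, ← WithLp.toLp_add]
  rw [SolvesTransport, h, LineDeriv.lineDerivOp_left_add, LineDeriv.lineDerivOp_left_smul]

theorem SolvesTransport.density_eq {κ : ℝ} {ψ F : 𝓢'(Spacetime, ℂ)} {h w : ℝ × ℝ → ℂ}
    (hψF : SolvesTransport κ ψ F) (hψ : HasFourierDensity ψ h) (hF : HasFourierDensity F w) :
    ∀ᵐ p : ℝ × ℝ, 2 * Real.pi * Complex.I * (p.1 + κ * p.2 : ℝ) * h p = w p := by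
  have hd := hψ.lineDeriv (pt 1 κ)
  rw [solvesTransport_iff.1 hψF] at hd
  filter_upwards [hd.ae_eq hF] with p hp
  rw [← hp, inner_pt, mul_one, mul_comm κ]
  rfl

theorem lineDeriv_timeMul (χ : 𝓢(ℝ, ℂ)) (v : Spacetime) (u : 𝓢'(Spacetime, ℂ)) :
    ∂_{v} (timeMul χ u) =
      v.fst • timeMul (SchwartzMap.derivCLM ℂ ℂ χ) u + timeMul χ (∂_{v} u) := by
  have hχ := hasTemperateGrowth_comp_fst χ.hasTemperateGrowth
  have hχ' : (fun p : Spacetime => deriv χ p.fst).HasTemperateGrowth :=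
    hasTemperateGrowth_comp_fst (SchwartzMap.derivCLM ℂ ℂ χ).hasTemperateGrowth
  ext φ
  have hφ : ∂_{v} (SchwartzMap.smulLeftCLM ℂ (fun p : Spacetime => χ p.fst) φ) =
      SchwartzMap.smulLeftCLM ℂ (fun p : Spacetime => χ p.fst) (∂_{v} φ) +
        v.fst • SchwartzMap.smulLeftCLM ℂ
          (fun p : Spacetime => SchwartzMap.derivCLM ℂ ℂ χ p.fst) φ := by
    ext x
    have hderiv : HasFDerivAt (fun p : Spacetime => χ p.fst) _ x :=
      (χ.differentiableAt (x := x.fst)).hasDerivAt.hasFDerivAt.comp x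
        (WithLp.fstL 2 ℝ ℝ ℝ : Spacetime →L[ℝ] ℝ).hasFDerivAt
    have hprod : fderiv ℝ (fun p : Spacetime => χ p.fst • φ p) x = _ :=
      (hderiv.mul (φ.hasFDerivAt x)).fderiv
    rw [SchwartzMap.lineDerivOp_apply_eq_fderiv, SchwartzMap.smulLeftCLM_apply hχ, hprod]
    simp [SchwartzMap.smulLeftCLM_apply_apply hχ, SchwartzMap.smulLeftCLM_apply_apply hχ',
      SchwartzMap.lineDerivOp_apply_eq_fderiv]
    ring
  change u (SchwartzMap.smulLeftCLM ℂ (fun p : Spacetime => χ p.fst) (-∂_{v} φ)) =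
    v.fst • u (SchwartzMap.smulLeftCLM ℂ
        (fun p : Spacetime => SchwartzMap.derivCLM ℂ ℂ χ p.fst) φ) +
      u (-∂_{v} (SchwartzMap.smulLeftCLM ℂ (fun p : Spacetime => χ p.fst) φ))
  rw [hφ, map_neg, map_neg, map_neg, map_add]
  rw [show u (v.fst • _) = v.fst • u _ from ContinuousLinearMap.map_smul_of_tower u _ _]
  abel

protected theorem SolvesTransport.timeMul {κ : ℝ} {ψ F : 𝓢'(Spacetime, ℂ)}
    (h : SolvesTransport κ ψ F) (χ : 𝓢(ℝ, ℂ)) :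
    SolvesTransport κ (timeMul χ ψ) (timeMul (SchwartzMap.derivCLM ℂ ℂ χ) ψ + timeMul χ F) := by
  rw [solvesTransport_iff] at h ⊢
  rw [lineDeriv_timeMul, h]
  exact congrArg (· + _) (one_smul ℝ _)

/-! ### Dilation of Schwartz functions -/

/-- The function `t ↦ η (t / T)`. -/
noncomputable def dilate (η : 𝓢(ℝ, ℂ)) {T : ℝ} (hT : T ≠ 0) : 𝓢(ℝ, ℂ) :=
  SchwartzMap.compCLMOfContinuousLinearEquiv ℂ
    (ContinuousLinearEquiv.smulLeft (Units.mk0 T⁻¹ (inv_ne_zero hT)) : ℝ ≃L[ℝ] ℝ) η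

theorem dilate_apply (η : 𝓢(ℝ, ℂ)) {T : ℝ} (hT : T ≠ 0) (t : ℝ) : dilate η hT t = η (t / T) := by
  simp [dilate, Units.smul_def, div_eq_inv_mul]

theorem cutoffMul_eq_timeMul_dilate (η : 𝓢(ℝ, ℂ)) {T : ℝ} (hT : T ≠ 0) (u : 𝓢'(Spacetime, ℂ)) :
    cutoffMul η T u = timeMul (dilate η hT) u := by
  simp only [cutoffMul, timeMul, dilate_apply]
  rfl

theorem derivCLM_dilate (η : 𝓢(ℝ, ℂ)) {T : ℝ} (hT : T ≠ 0) :
    SchwartzMap.derivCLM ℂ ℂ (dilate η hT) = T⁻¹ • dilate (SchwartzMap.derivCLM ℂ ℂ η) hT := by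
  ext t
  have h : ⇑(dilate η hT) = fun t => η (T⁻¹ * t) := by
    simp only [funext (dilate_apply η hT), div_eq_inv_mul]
  simp [h, dilate_apply, deriv_comp_mul_left, div_eq_inv_mul]

theorem fourier_dilate (η : 𝓢(ℝ, ℂ)) {T : ℝ} (hT : T ≠ 0) (ν : ℝ) :
    𝓕 (dilate η hT) ν = |T| • 𝓕 η (T * ν) := by
  simp only [SchwartzMap.fourier_coe, Real.fourier_eq, dilate_apply]
  rw [← Measure.integral_comp_div]
  refine integral_congr_ae (.of_forall fun t => ?_)
  simp only [RCLike.inner_apply, conj_trivial]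
  congr 3
  field_simp

theorem exists_enorm_fourier_dilate_le (η : 𝓢(ℝ, ℂ)) (n : ℕ) :
    ∃ A : ℝ≥0, ∀ {T : ℝ} (hT : 0 < T) (ν : ℝ),
      ‖𝓕 (dilate η hT.ne') ν‖ₑ ≤ A * ENNReal.ofReal (decayKernel n T ν) := by
  obtain ⟨A, hA⟩ := exists_norm_le_mul_inv_one_add_norm_pow (𝓕 η) n
  refine ⟨A, fun {T} hT ν => ?_⟩
  rw [← ENNReal.ofReal_coe_nnreal, ← ENNReal.ofReal_mul A.coe_nonneg, ← ofReal_norm]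
  refine ENNReal.ofReal_le_ofReal ?_
  rw [fourier_dilate, norm_smul, Real.norm_eq_abs, abs_abs, abs_of_pos hT, decayKernel,
    mul_left_comm]
  gcongr
  exact hA (T * ν)

theorem exists_enorm_fourier_derivCLM_dilate_le (η : 𝓢(ℝ, ℂ)) (n : ℕ) :
    ∃ A : ℝ≥0, ∀ {T : ℝ} (hT : 0 < T) (ν : ℝ),
      ‖𝓕 (SchwartzMap.derivCLM ℂ ℂ (dilate η hT.ne')) ν‖ₑ ≤
        A * ENNReal.ofReal T⁻¹ * ENNReal.ofReal (decayKernel n T ν) := by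
  obtain ⟨A, hA⟩ := exists_enorm_fourier_dilate_le (SchwartzMap.derivCLM ℂ ℂ η) n
  refine ⟨A, fun {T} hT ν => ?_⟩
  rw [derivCLM_dilate, FourierTransform.fourier_smul, smul_apply, enorm_smul,
    Real.enorm_of_nonneg (inv_nonneg.2 hT.le), mul_assoc, mul_left_comm]
  gcongr
  exact hA hT ν

/-! ### The norms of `Z^{s,b}` and `Y^{s,0}` in terms of densities -/

theorem lintegral_mul_lt_top_of_eLpNorm_two_lt_top {α : Type*} [MeasurableSpace α] {μ : Measure α}
    {u v : α → ℝ≥0∞} (hu : AEMeasurable u μ) (hv : AEMeasurable v μ) (hu2 : eLpNorm u 2 μ < ⊤)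
    (hv2 : eLpNorm v 2 μ < ⊤) : ∫⁻ x, u x * v x ∂μ < ⊤ := by
  refine (ENNReal.lintegral_mul_le_Lp_mul_Lq μ .two_two hu hv).trans_lt ?_
  simpa [eLpNorm_eq_lintegral_rpow_enorm_toReal] using ENNReal.mul_lt_top hu2 hv2

theorem eLpNorm_two_ofReal_one_add_norm_pow_inv_lt_top {E : Type*} [NormedAddCommGroup E]
    [NormedSpace ℝ E] [FiniteDimensional ℝ E] [MeasurableSpace E] [BorelSpace E] (μ : Measure E)
    [μ.IsAddHaarMeasure] {N : ℕ} (hN : Module.finrank ℝ E < 2 * N) :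
    eLpNorm (fun x => ENNReal.ofReal ((1 + ‖x‖) ^ N)⁻¹) 2 μ < ⊤ := by
  refine lt_of_pow_lt_pow_left' 2 ?_
  rw [ENNReal.top_pow two_ne_zero, eLpNorm_two_sq]
  refine (lintegral_congr fun x => ?_).trans_lt
    (finite_integral_one_add_norm (μ := μ) (r := ((2 * N : ℕ) : ℝ)) (by exact_mod_cast hN))
  rw [Real.rpow_neg (by positivity), Real.rpow_natCast, ← ENNReal.ofReal_pow (by positivity),
    inv_pow, mul_comm 2 N, pow_mul]

theorem inv_le_rpow_of_le {x y s : ℝ} (hx : 1 ≤ x) (hxy : x ≤ y) (hs : -1 ≤ s) :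
    y⁻¹ ≤ x ^ s := by
  calc y⁻¹ ≤ x⁻¹ := inv_anti₀ (by linarith) hxy
    _ = x ^ (-1 : ℝ) := (Real.rpow_neg_one x).symm
    _ ≤ _ := Real.rpow_le_rpow_of_exponent_le hx hs

theorem TemperedIntegrable.of_eLpNorm_lintegral_lt_top {s : ℝ} (hs : -1 ≤ s) {g : ℝ × ℝ → ℂ}
    (hg : Measurable g)
    (h : eLpNorm (fun ξ => ∫⁻ τ, ENNReal.ofReal (bracket ξ ^ s) * ‖g (τ, ξ)‖ₑ) 2 < ⊤) :
    TemperedIntegrable g := by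
  refine ⟨2, ?_⟩
  have hweight (τ ξ : ℝ) :
      ((1 + ‖((τ, ξ) : ℝ × ℝ)‖) ^ 2)⁻¹ ≤ ((1 + ‖ξ‖) ^ 1)⁻¹ * bracket ξ ^ s := by
    have hξ : ‖ξ‖ ≤ ‖((τ, ξ) : ℝ × ℝ)‖ := norm_snd_le (τ, ξ)
    calc ((1 + ‖((τ, ξ) : ℝ × ℝ)‖) ^ 2)⁻¹ ≤ ((1 + ‖ξ‖) ^ 2)⁻¹ := by gcongr
      _ = ((1 + ‖ξ‖) ^ 1)⁻¹ * (1 + ‖ξ‖)⁻¹ := by rw [pow_one, sq, mul_inv]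
      _ ≤ _ := by
        gcongr
        exact inv_le_rpow_of_le (one_le_bracket ξ) (bracket_le_one_add_abs ξ) hs
  have hmeas : Measurable fun ξ => ∫⁻ τ, ENNReal.ofReal (bracket ξ ^ s) * ‖g (τ, ξ)‖ₑ :=
    Measurable.lintegral_prod_right' (f := fun p : ℝ × ℝ =>
      ENNReal.ofReal (bracket p.1 ^ s) * ‖g (p.2, p.1)‖ₑ) (by fun_prop)
  rw [Measure.volume_eq_prod, lintegral_prod_symm' _ (by fun_prop)]
  refine lt_of_le_of_lt ?_ (lintegral_mul_lt_top_of_eLpNorm_two_lt_top (by fun_prop)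
    hmeas.aemeasurable (eLpNorm_two_ofReal_one_add_norm_pow_inv_lt_top (E := ℝ) volume (N := 1)
      (by simp)) h)
  refine lintegral_mono fun ξ => ?_
  rw [← lintegral_const_mul' _ _ ENNReal.ofReal_ne_top]
  refine lintegral_mono fun τ => ?_
  rw [← mul_assoc, ← ENNReal.ofReal_mul (by positivity)]
  gcongr ENNReal.ofReal ?_ * _
  exact hweight τ ξ

theorem inv_one_add_norm_pow_le_mul_zWeight {κ s a : ℝ} (hs : -1 ≤ s) (ha : -1 ≤ a) (p : ℝ × ℝ) :
    ((1 + ‖p‖) ^ 4)⁻¹ ≤ (1 + |κ|) ^ 2 * (((1 + ‖p‖) ^ 2)⁻¹ * zWeight κ s a p) := by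
  have hκp : |κ * p.2| ≤ |κ| * ‖p‖ := by
    rw [abs_mul]
    gcongr
    exact norm_snd_le p
  have hp : |p.1| ≤ ‖p‖ := norm_fst_le p
  have hsub : bracket (p.1 - κ * p.2) ≤ (1 + |κ|) * (1 + ‖p‖) := by
    linarith [bracket_le_one_add_abs (p.1 - κ * p.2), abs_sub p.1 (κ * p.2), abs_nonneg κ]
  have hadd : bracket (p.1 + κ * p.2) ≤ (1 + |κ|) * (1 + ‖p‖) := by
    linarith [bracket_le_one_add_abs (p.1 + κ * p.2), abs_add_le p.1 (κ * p.2), abs_nonneg κ]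
  calc ((1 + ‖p‖) ^ 4)⁻¹ = (1 + |κ|) ^ 2 * (((1 + ‖p‖) ^ 2)⁻¹ *
        (((1 + |κ|) * (1 + ‖p‖))⁻¹ * ((1 + |κ|) * (1 + ‖p‖))⁻¹)) := by field_simp
    _ ≤ _ := by
      have := Real.rpow_nonneg (bracket_pos (p.1 - κ * p.2)).le s
      unfold zWeight
      gcongr
      · exact inv_le_rpow_of_le (one_le_bracket _) hsub hs
      · exact inv_le_rpow_of_le (one_le_bracket _) hadd ha

theorem TemperedIntegrable.of_eLpNorm_zWeight_mul_lt_top {κ s a : ℝ} (hs : -1 ≤ s) (ha : -1 ≤ a)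
    {f : ℝ × ℝ → ℂ} (hf : Measurable f)
    (h : eLpNorm (fun p => ENNReal.ofReal (zWeight κ s a p) * ‖f p‖ₑ) 2 < ⊤) :
    TemperedIntegrable f := by
  refine ⟨4, lt_of_le_of_lt ?_ (ENNReal.mul_lt_top (ENNReal.ofReal_lt_top (r := (1 + |κ|) ^ 2))
    (lintegral_mul_lt_top_of_eLpNorm_two_lt_top (by fun_prop) (by fun_prop)
      (eLpNorm_two_ofReal_one_add_norm_pow_inv_lt_top (E := ℝ × ℝ) volume (N := 2)
        (by simp)) h))⟩
  rw [← lintegral_const_mul' _ _ ENNReal.ofReal_ne_top]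
  refine lintegral_mono fun p => ?_
  rw [← mul_assoc, ← mul_assoc, ← ENNReal.ofReal_mul (by positivity),
    ← ENNReal.ofReal_mul (by positivity), mul_assoc]
  gcongr ENNReal.ofReal ?_ * _
  exact inv_one_add_norm_pow_le_mul_zWeight hs ha p

theorem HasFourierDensity.zNorm_eq {u : 𝓢'(Spacetime, ℂ)} {g : ℝ × ℝ → ℂ}
    (hg : HasFourierDensity u g) (κ s b : ℝ) :
    ZNorm κ s b u = eLpNorm (fun p => ENNReal.ofReal (zWeight κ s b p) * ‖g p‖ₑ) 2 := by
  have hnorm (h : ℝ × ℝ → ℂ) (hh : HasFourierDensity u h) :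
      (∫⁻ p : ℝ × ℝ, (ENNReal.ofReal (zWeight κ s b p) * ‖h p‖ₑ) ^ (2 : ℝ)) ^ (1 / 2 : ℝ) =
        eLpNorm (fun p => ENNReal.ofReal (zWeight κ s b p) * ‖g p‖ₑ) 2 := by
    rw [eLpNorm_congr_ae ((hg.ae_eq hh).mono fun p hp => by
      simp only [hp] : _ =ᵐ[volume] fun p => ENNReal.ofReal (zWeight κ s b p) * ‖h p‖ₑ)]
    simp [eLpNorm_eq_lintegral_rpow_enorm_toReal]
  exact le_antisymm (iInf₂_le_of_le g hg (hnorm g hg).le) (le_iInf₂ fun h hh => (hnorm h hh).ge)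

theorem HasFourierDensity.yNorm_eq {u : 𝓢'(Spacetime, ℂ)} {g : ℝ × ℝ → ℂ}
    (hg : HasFourierDensity u g) (κ s : ℝ) :
    YNorm κ s 0 u =
      eLpNorm (fun ξ => ∫⁻ τ, ENNReal.ofReal (bracket ξ ^ s) * ‖g (τ, ξ)‖ₑ) 2 := by
  have hnorm (h : ℝ × ℝ → ℂ) (hh : HasFourierDensity u h) :
      (∫⁻ ξ, (∫⁻ τ, ENNReal.ofReal (bracket ξ ^ s * bracket (τ + κ * ξ) ^ (0 : ℝ)) *
        ‖h (τ, ξ)‖ₑ) ^ (2 : ℝ)) ^ (1 / 2 : ℝ) =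
          eLpNorm (fun ξ => ∫⁻ τ, ENNReal.ofReal (bracket ξ ^ s) * ‖g (τ, ξ)‖ₑ) 2 := by
    have hslice : ∀ᵐ ξ : ℝ, ∀ᵐ τ : ℝ, g (τ, ξ) = h (τ, ξ) :=
      Measure.ae_ae_of_ae_prod
        (Measure.measurePreserving_swap.quasiMeasurePreserving.ae (hg.ae_eq hh))
    rw [eLpNorm_congr_ae (hslice.mono fun ξ hξ => lintegral_congr_ae (hξ.mono fun τ hτ => by
      simp only [hτ]) : _ =ᵐ[volume]
        fun ξ => ∫⁻ τ, ENNReal.ofReal (bracket ξ ^ s) * ‖h (τ, ξ)‖ₑ)]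
    simp [eLpNorm_eq_lintegral_rpow_enorm_toReal]
  exact le_antisymm (iInf₂_le_of_le g hg (hnorm g hg).le) (le_iInf₂ fun h hh => (hnorm h hh).ge)

theorem HasFourierDensity.exists_measurable {u : 𝓢'(Spacetime, ℂ)} {g : ℝ × ℝ → ℂ}
    (hg : HasFourierDensity u g) : ∃ h, Measurable h ∧ HasFourierDensity u h :=
  ⟨hg.1.mk g, hg.1.stronglyMeasurable_mk.measurable, hg.congr_ae hg.1.ae_eq_mk⟩

theorem exists_hasFourierDensity_of_zNorm_ne_top {κ s b : ℝ} {u : 𝓢'(Spacetime, ℂ)}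
    (hs : -1 ≤ s) (hb : -1 ≤ b) (h : ZNorm κ s b u ≠ ⊤) :
    ∃ g, Measurable g ∧ TemperedIntegrable g ∧ HasFourierDensity u g := by
  obtain ⟨g₀, hlt⟩ := iInf_lt_iff.1 h.lt_top
  obtain ⟨hg₀, -⟩ := iInf_lt_iff.1 hlt
  obtain ⟨g, hgm, hg⟩ := hg₀.exists_measurable
  rw [hg.zNorm_eq] at h
  exact ⟨g, hgm, .of_eLpNorm_zWeight_mul_lt_top hs hb hgm h.lt_top, hg⟩

theorem exists_hasFourierDensity_of_yNorm_ne_top {κ s : ℝ} {u : 𝓢'(Spacetime, ℂ)}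
    (hs : -1 ≤ s) (h : YNorm κ s 0 u ≠ ⊤) :
    ∃ g, Measurable g ∧ TemperedIntegrable g ∧ HasFourierDensity u g := by
  obtain ⟨g₀, hlt⟩ := iInf_lt_iff.1 h.lt_top
  obtain ⟨hg₀, -⟩ := iInf_lt_iff.1 hlt
  obtain ⟨g, hgm, hg⟩ := hg₀.exists_measurable
  rw [hg.yNorm_eq] at h
  exact ⟨g, hgm, .of_eLpNorm_lintegral_lt_top hs hgm h.lt_top, hg⟩

theorem timeMul_cutoffMul {σ : ℝ → ℂ} (hσ : σ.HasTemperateGrowth) {χ : 𝓢(ℝ, ℂ)} {T : ℝ}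
    (hσχ : ∀ t, χ t ≠ 0 → σ (t / T) = 1) (u : 𝓢'(Spacetime, ℂ)) :
    timeMul χ (cutoffMul σ T u) = timeMul χ u := by
  have hσT : (fun t => σ (t / T)).HasTemperateGrowth := by
    simpa [Function.comp_def, div_eq_inv_mul] using
      hσ.comp (T⁻¹ • ContinuousLinearMap.id ℝ ℝ).hasTemperateGrowth
  have hmul : (fun t => σ (t / T)) * χ = χ := by
    ext t
    by_cases ht : χ t = 0
    · simp [ht]
    · simp [hσχ t ht]
  exact (timeMul_timeMul χ.hasTemperateGrowth hσT u).trans (by rw [hmul])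

theorem timeMul_dilate_cutoffMul {ρ : 𝓢(ℝ, ℂ)} {σ : ℝ → ℂ} (hσ : σ.HasTemperateGrowth)
    (hσρ : ∀ t ∈ tsupport ρ, σ t = 1) {T : ℝ} (hT : T ≠ 0) (u : 𝓢'(Spacetime, ℂ)) :
    timeMul (dilate ρ hT) (cutoffMul σ T u) = timeMul (dilate ρ hT) u := by
  refine timeMul_cutoffMul hσ (fun t ht => hσρ _ (subset_tsupport _ ?_)) u
  rwa [dilate_apply] at ht

theorem timeMul_derivCLM_dilate_cutoffMul {ρ : 𝓢(ℝ, ℂ)} {σ : ℝ → ℂ} (hσ : σ.HasTemperateGrowth)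
    (hσρ : ∀ t ∈ tsupport ρ, σ t = 1) {T : ℝ} (hT : T ≠ 0) (u : 𝓢'(Spacetime, ℂ)) :
    timeMul (SchwartzMap.derivCLM ℂ ℂ (dilate ρ hT)) (cutoffMul σ T u) =
      timeMul (SchwartzMap.derivCLM ℂ ℂ (dilate ρ hT)) u := by
  refine timeMul_cutoffMul hσ (fun t ht => hσρ _ (support_deriv_subset ?_)) u
  rw [derivCLM_dilate, smul_apply, dilate_apply] at ht
  exact right_ne_zero_of_smul ht

theorem SolvesTransport.ofReal_mul_enorm_freqConv_le {κ : ℝ} {u ψ F : 𝓢'(Spacetime, ℂ)}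
    {g f : ℝ × ℝ → ℂ} {χ : 𝓢(ℝ, ℂ)} (h : SolvesTransport κ ψ F)
    (hχ : timeMul χ u = timeMul χ ψ)
    (hχ' : timeMul (SchwartzMap.derivCLM ℂ ℂ χ) u = timeMul (SchwartzMap.derivCLM ℂ ℂ χ) ψ)
    (hg : Measurable g) (hgt : TemperedIntegrable g) (hu : HasFourierDensity u g)
    (hf : Measurable f) (hft : TemperedIntegrable f) (hF : HasFourierDensity F f) :
    ∀ᵐ p : ℝ × ℝ, ENNReal.ofReal |p.1 + κ * p.2| * ‖freqConv (𝓕 χ : 𝓢(ℝ, ℂ)) g p‖ₑ ≤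
      ‖freqConv (𝓕 (SchwartzMap.derivCLM ℂ ℂ χ) : 𝓢(ℝ, ℂ)) g p‖ₑ +
        ‖freqConv (𝓕 χ : 𝓢(ℝ, ℂ)) f p‖ₑ := by
  have hψ := hu.timeMul hg hgt χ
  have hψ' := hu.timeMul hg hgt (SchwartzMap.derivCLM ℂ ℂ χ)
  rw [hχ] at hψ
  rw [hχ'] at hψ'
  filter_upwards [(h.timeMul χ).density_eq hψ (hψ'.add (hF.timeMul hf hft χ))] with p hp
  calc ENNReal.ofReal |p.1 + κ * p.2| * ‖freqConv (𝓕 χ : 𝓢(ℝ, ℂ)) g p‖ₑ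
      ≤ ‖2 * Real.pi * Complex.I * (p.1 + κ * p.2 : ℝ) * freqConv (𝓕 χ : 𝓢(ℝ, ℂ)) g p‖ₑ := by
        rw [enorm_mul, ← ofReal_norm (2 * _ * _ * _ : ℂ)]
        gcongr
        simp only [norm_mul, Complex.norm_real, Complex.norm_I, Real.norm_eq_abs, mul_one,
          Complex.norm_ofNat, abs_of_pos Real.pi_pos]
        nlinarith [Real.pi_gt_three, abs_nonneg (p.1 + κ * p.2)]
    _ ≤ _ := by
        rw [hp]
        exact enorm_add_le _ _

theorem exists_zNorm_cutoffMul_le_of_hasFourierDensity {s ε b : ℝ} (hs : -1 / 2 < s) (hs' : s ≤ 0)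
    (hε : 0 ≤ ε) (hb : 0 ≤ b) (hbs : b ≤ 1 + s) (hbε : b ≤ 1 - ε) (ρ : 𝓢(ℝ, ℂ)) {σ : ℝ → ℂ}
    (hσ : σ.HasTemperateGrowth) (hσρ : ∀ t ∈ tsupport ρ, σ t = 1) {κ : ℝ} (hκ : κ ≠ 0) :
    ∃ C : ℝ≥0, ∀ T : ℝ, 0 < T → T ≤ 1 → ∀ {ψ F : 𝓢'(Spacetime, ℂ)}, SolvesTransport κ ψ F →
      ∀ {g f : ℝ × ℝ → ℂ}, Measurable g → TemperedIntegrable g →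
        HasFourierDensity (cutoffMul σ T ψ) g → Measurable f → TemperedIntegrable f →
        HasFourierDensity F f →
        ZNorm κ s b (cutoffMul ρ T ψ) ≤
          C * (ENNReal.ofReal (T ^ (1 / 2 - b)) * YNorm κ s 0 (cutoffMul σ T ψ) +
            ENNReal.ofReal (T ^ ε) * ZNorm κ s (b - 1 + ε) F) := by
  obtain ⟨A, hA⟩ := exists_enorm_fourier_dilate_le ρ 4
  obtain ⟨A', hA'⟩ := exists_enorm_fourier_derivCLM_dilate_le ρ 4
  obtain ⟨C, hC⟩ := exists_eLpNorm_zWeight_mul_le hκ hs hs' hε hb hbs hbε (A + A')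
  refine ⟨C, fun T hT hT1 ψ F h g f hg hgt hψ hf hft hF => ?_⟩
  have hχ := timeMul_dilate_cutoffMul hσ hσρ hT.ne' ψ
  have hχ' := timeMul_derivCLM_dilate_cutoffMul hσ hσρ hT.ne' ψ
  have hρψ := hψ.timeMul hg hgt (dilate ρ hT.ne')
  rw [hχ, ← cutoffMul_eq_timeMul_dilate] at hρψ
  rw [hρψ.zNorm_eq, hψ.yNorm_eq, hF.zNorm_eq]
  have hA_le : (A : ℝ≥0∞) ≤ ↑(A + A') := by exact_mod_cast le_self_add
  have hA'_le : (A' : ℝ≥0∞) ≤ ↑(A + A') := by exact_mod_cast le_add_self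
  refine hC T hT hT1 (g := fun p => ‖g p‖ₑ) (f := fun p => ‖f p‖ₑ) hg.enorm hf.enorm
    (fun p => (enorm_freqConv_le (by finiteness) (hA hT) g p).trans ?_) ?_
  · gcongr
  · filter_upwards [h.ofReal_mul_enorm_freqConv_le hχ hχ' hg hgt hψ hf hft hF] with p hp
    calc _ ≤ _ := hp
      _ ≤ A' * ENNReal.ofReal T⁻¹ * decayConv 4 T (fun q => ‖g q‖ₑ) p +
            A * decayConv 4 T (fun q => ‖f q‖ₑ) p :=
          add_le_add (enorm_freqConv_le (by finiteness) (hA' hT) g p)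
            (enorm_freqConv_le (by finiteness) (hA hT) f p)
      _ ≤ _ := by
          rw [mul_assoc, mul_add]
          gcongr

end NullEnergy

open NullEnergy in
theorem proposition4p3_general {s ε b : ℝ} (hs : -1 / 2 < s) (hs' : s ≤ 0) (hε : 0 ≤ ε)
    (hb : 0 ≤ b) (hbs : b ≤ 1 + s) (hbε : b ≤ 1 - ε) (ρ : 𝓢(ℝ, ℂ)) {σ : ℝ → ℂ}
    (hσ : σ.HasTemperateGrowth) (hσρ : ∀ t ∈ tsupport ρ, σ t = 1) {κ : ℝ} (hκ : κ ≠ 0) :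
    ∃ C : ℝ≥0, ∀ T : ℝ, 0 < T → T ≤ 1 → ∀ ψ F : 𝓢'(Spacetime, ℂ), SolvesTransport κ ψ F →
      ZNorm κ s b (cutoffMul ρ T ψ) ≤
        C * (ENNReal.ofReal (T ^ (1 / 2 - b)) * YNorm κ s 0 (cutoffMul σ T ψ) +
          ENNReal.ofReal (T ^ ε) * ZNorm κ s (b - 1 + ε) F) := by
  obtain ⟨C, hC⟩ :=
    exists_zNorm_cutoffMul_le_of_hasFourierDensity hs hs' hε hb hbs hbε ρ hσ hσρ hκ
  refine ⟨C + 1, fun T hT hT1 ψ F h => ?_⟩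
  have hTpow (a : ℝ) : ENNReal.ofReal (T ^ a) ≠ 0 :=
    (ENNReal.ofReal_pos.2 (Real.rpow_pos_of_pos hT a)).ne'
  by_cases hY : YNorm κ s 0 (cutoffMul σ T ψ) = ⊤
  · simp [hY, ENNReal.mul_top (hTpow _)]
  by_cases hZ : ZNorm κ s (b - 1 + ε) F = ⊤
  · simp [hZ, ENNReal.mul_top (hTpow _)]
  obtain ⟨g, hg, hgt, hψ⟩ := exists_hasFourierDensity_of_yNorm_ne_top (by linarith) hY
  obtain ⟨f, hf, hft, hF⟩ :=
    exists_hasFourierDensity_of_zNorm_ne_top (by linarith) (by linarith) hZ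
  refine (hC T hT hT1 h hg hgt hψ hf hft hF).trans ?_
  gcongr
  exact le_self_add

theorem proposition4p3 (s ε b : ℝ) (hs : -1 / 2 < s) (hs' : s ≤ 0) (hε : 0 < ε) (hε' : ε < 1 / 2)
    (hb : 1 / 2 < b) (hb' : b < min (1 + s) (1 - ε))
    (ρ σ : ℝ → ℂ) (hρ : ContDiff ℝ ∞ ρ) (hρc : HasCompactSupport ρ)
    (hσ : ContDiff ℝ ∞ σ) (hσc : HasCompactSupport σ)
    (hρ1 : ∀ t ∈ Set.Icc (-1 : ℝ) 1, ρ t = 1) (hσ1 : ∀ t ∈ tsupport ρ, σ t = 1)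
    (hρσ : tsupport ρ ⊆ tsupport σ) (hσ2 : tsupport σ ⊆ Set.Icc (-2 : ℝ) 2)
    (κ : ℝ) (hκ : κ = 1 ∨ κ = -1) :
    ∃ C : ℝ≥0, ∀ T : ℝ, 0 < T → T < 1 →
      ∀ ψ F : 𝓢'(NullEnergy.Spacetime, ℂ), NullEnergy.SolvesTransport κ ψ F →
        NullEnergy.ZNorm κ s b (NullEnergy.cutoffMul ρ T ψ) ≤
          C * (ENNReal.ofReal (T ^ (1 / 2 - b)) *
                NullEnergy.YNorm κ s 0 (NullEnergy.cutoffMul σ T ψ) +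
              ENNReal.ofReal (T ^ ε) * NullEnergy.ZNorm κ s (b - 1 + ε) F) := by
  have ⟨hbs, hbε⟩ := lt_min_iff.1 hb'
  have hκ0 : κ ≠ 0 := by rcases hκ with rfl | rfl <;> norm_num
  have ⟨C, hC⟩ := proposition4p3_general hs hs' hε.le (by linarith) hbs.le hbε.le
    (hρc.toSchwartzMap hρ) (hσc.hasTemperateGrowth hσ) hσ1 hκ0
  exact ⟨C, fun T hT hT1 => hC T hT hT1.le⟩
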